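/- **Setting.** Let $n\ge 2$ and let $h(x,x)=x_1^2+\dots+x_n^2-x_{n+1}^2$ on $\mathbb R^{n+1}$. Put $G=SL(n+1,\mathbb R)$, let $SO(n,1)\subset G$ be the subgroup preserving $h$, and let $SO_o(n,1)$ be the subgroup of $SO(n,1)$ preserving the sheet $\{h(x,x)=-1,\ x_{n+1}>0\}$; this sheet is $\mathbb H^n$. Let $P\subset G$ be the stabiliser of the ray through $e_{n+1}$, so that $G/P$ is the sphere of rays of $\mathbb R^{n+1}$, $gP$ corresponding to the ray through $g e_{n+1}$; identify $\mathbb H^n$ with the open set of rays through points of the sheet. Let $\Gamma\subset SO_o(n,1)$ be a discrete torsion-free subgroup with $M=\Gamma\backslash\mathbb H^n$ compact. * *Canonical flat bundle.* For a finite-dimensional real representation $\mu:SO(n,1)\to GL(\mathbb F)$ let $F=\mathbb H^n\times_{dev}\mathbb F=(\mathbb H^n\times\mathbb F)/\!\sim$, with $(x,v)\sim(\gamma x,\mu(\gamma)v)$ for $\gamma\in\Gamma$. A section $s$ of $F$ is the same as a function $f:\mathbb H^n\to\mathbb F$ with $s(\Gamma x)=[x,f(x)]$ (so $f(\gamma x)=\mu(\gamma)f(x)$),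 and $\nabla^{dev}$ is the connection induced by the trivial one: $\nabla^{dev}_Xs=[x,df(\tilde X)]$ for every tangent vector $\tilde X$ of $\mathbb H^n$ at $x$ that projects to $X$. * *Tractor bundle.* Let $\mathcal G_\Gamma$ be the part over $M$ of $\Gamma\backslash G$, a principal $P$-bundle over $M$, with the Cartan connection $\omega$ induced by the Maurer–Cartan form $g^{-1}dg$ of $G$. For a finite-dimensional real (smooth) representation $\rho:G\to GL(\mathbb E)$ let $\mathcal T_{\mathbb E}=\mathcal G_\Gamma\times_\rho\mathbb E$ be the quotient of $\mathcal G_\Gamma\times\mathbb E$ by $(u,v)\sim(up,\rho(p)^{-1}v)$, $p\in P$. A section $s$ is the same as a function $\sigma:\mathcal G_\Gamma\to\mathbb E$ with $s(\pi(u))=[u,\sigma(u)]$ (so $\sigma(up)=\rho(p)^{-1}\sigma(u)$), and the tractor connection is $\nabla^{\mathcal T_{\mathbb E}}_Xs=[u,\ \tilde X\cdot\sigma+d\rho(\omega(\tilde X))\sigma(u)]$ for every tangent vector $\tilde X$ of $\mathcal G_\Gamma$ at $u$ that projects to $X$. **Theorem.** Let $\rho:SL(n+1,\mathbb R)\to GL(\mathbb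 E)$ and $\mu:SO(n,1)\to GL(\mathbb F)$ be finite-dimensional representations, and let $\theta:\mathbb F\to\mathbb E$ be an isomorphism of $\mu$ with $\rho|_{SO(n,1)}$. Then $\nabla^{dev}$ and $\nabla^{\mathcal T_{\mathbb E}}$ are well-defined smooth flat connections on the smooth vector bundles $F$ and $\mathcal T_{\mathbb E}$ over $M$, and there is a canonical isomorphism of flat vector bundles $$\Phi:(F,\nabla^{dev})\xrightarrow{\ \simeq\ }(\mathcal T_{\mathbb E},\nabla^{\mathcal T_{\mathbb E}}),$$ that is, a smooth isomorphism of vector bundles over the identity of $M$, with smooth inverse, such that $\Phi(\nabla^{dev}_Xs)=\nabla^{\mathcal T_{\mathbb E}}_X(\Phi\circ s)$; it is given by $$\Phi\big([x,v]\big)=\big[[g],\,\rho(g)^{-1}\theta(v)\big]\qquad\text{for every } g\in G \text{ with } gP=x .$$ -/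

import Mathlib

open Set Filter Topology Bundle
open scoped Manifold ContDiff Matrix

noncomputable section

namespace HypTractor

/-- The Lorentzian form `h(x, y) = x₁y₁ + ⋯ + xₙyₙ - xₙ₊₁yₙ₊₁` on `ℝⁿ⁺¹`. -/
def lorentz {n : ℕ} (x y : Fin (n + 1) → ℝ) : ℝ :=
  ∑ i : Fin n, x i.castSucc * y i.castSucc - x (Fin.last n) * y (Fin.last n)

/-- The positive sheet of the hyperboloid `h(x, x) = -1`. -/
def sheet (n : ℕ) : Set (Fin (n + 1) → ℝ) :=
  {x | lorentz x x = -1 ∧ 0 < x (Fin.last n)}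

/-- Hyperbolic space `ℍⁿ`. -/
def HypSpace (n : ℕ) : Type := sheet n

instance (n : ℕ) : CoeOut (HypSpace n) (Fin (n + 1) → ℝ) := ⟨Subtype.val⟩

instance (n : ℕ) : TopologicalSpace (HypSpace n) :=
  inferInstanceAs (TopologicalSpace (sheet n))

instance (n : ℕ) : T2Space (HypSpace n) := inferInstanceAs (T2Space (sheet n))

theorem HypSpace.ext {n : ℕ} {x y : HypSpace n} (h : (x : Fin (n + 1) → ℝ) = y) : x = y :=
  Subtype.ext h

theorem HypSpace.continuous_val {n : ℕ} :
    Continuous (fun x : HypSpace n => (x : Fin (n + 1) → ℝ)) := continuous_subtype_val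

theorem lorentz_snoc {n : ℕ} (y : Fin n → ℝ) (t : ℝ) :
    lorentz (Fin.snoc y t : Fin (n + 1) → ℝ) (Fin.snoc y t) = ∑ i, y i * y i - t * t := by
  simp [lorentz]

/-- The global coordinates `(x₁, …, xₙ)` on `ℍⁿ`: a homeomorphism onto `ℝⁿ`, the hyperboloid sheet
being the graph of `y ↦ √(1 + |y|²)`. -/
def HypSpace.coord (n : ℕ) : HypSpace n ≃ₜ EuclideanSpace ℝ (Fin n) where
  toFun x := WithLp.toLp 2 (fun i => x.1 i.castSucc)
  invFun y := ⟨Fin.snoc (fun i => y i) (√(1 + ∑ i, y i * y i)), by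
    have h : 0 < 1 + ∑ i, y i * y i := by
      have : 0 ≤ ∑ i, y i * y i := Finset.sum_nonneg fun i _ => mul_self_nonneg _
      linarith
    refine ⟨?_, by simpa using h⟩
    rw [lorentz_snoc, Real.mul_self_sqrt h.le]; ring⟩
  left_inv x := by
    obtain ⟨x, hx, hx'⟩ := x
    apply Subtype.ext
    simp only [lorentz] at hx
    have : 1 + ∑ i : Fin n, x i.castSucc * x i.castSucc = x (Fin.last n) * x (Fin.last n) := by
      linarith
    simp only [this, Real.sqrt_mul_self hx'.le]
    ext i
    refine Fin.lastCases ?_ (fun j => ?_) i <;> simp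
  right_inv y := by ext i; simp
  continuous_toFun := by
    refine (PiLp.continuous_toLp 2 _).comp ?_
    exact continuous_pi fun i => (continuous_apply _).comp continuous_subtype_val
  continuous_invFun := by
    refine Continuous.subtype_mk (continuous_pi fun i => ?_) _
    refine Fin.lastCases ?_ (fun j => ?_) i
    · simp only [Fin.snoc_last]; fun_prop
    · simp only [Fin.snoc_castSucc]; fun_prop

theorem HypSpace.coord_symm_apply {n : ℕ} (y : EuclideanSpace ℝ (Fin n)) :
    (((HypSpace.coord n).symm y : HypSpace n) : Fin (n + 1) → ℝ) =
      Fin.snoc (fun i => y i) (√(1 + ∑ i, y i * y i)) := rfl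

instance (n : ℕ) : LocallyCompactSpace (HypSpace n) :=
  (HypSpace.coord n).isClosedEmbedding.locallyCompactSpace

instance (n : ℕ) : Nonempty (HypSpace n) := ⟨(HypSpace.coord n).symm 0⟩

/-- The smooth structure of `ℍⁿ` as a hypersurface of `ℝⁿ⁺¹`, given by the global chart. -/
instance (n : ℕ) : ChartedSpace (EuclideanSpace ℝ (Fin n)) (HypSpace n) :=
  (HypSpace.coord n).isOpenEmbedding.singletonChartedSpace

instance (n : ℕ) : IsManifold (𝓡 n) ∞ (HypSpace n) :=
  (HypSpace.coord n).isOpenEmbedding.isManifold_singleton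

theorem HypSpace.contMDiff_val (n : ℕ) :
    ContMDiff (𝓡 n) 𝓘(ℝ, Fin (n + 1) → ℝ) ∞ (fun x : HypSpace n => (x : Fin (n + 1) → ℝ)) := by
  have h1 : ContDiff ℝ ∞ (fun y : EuclideanSpace ℝ (Fin n) =>
      (((HypSpace.coord n).symm y : HypSpace n) : Fin (n + 1) → ℝ)) := by
    rw [contDiff_pi]
    intro i
    refine Fin.lastCases ?_ (fun j => ?_) i
    · simp only [HypSpace.coord_symm_apply, Fin.snoc_last]
      refine ContDiff.sqrt (by fun_prop) fun y => ?_
      have : 0 ≤ ∑ i, y i * y i := Finset.sum_nonneg fun i _ => mul_self_nonneg _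
      positivity
    · simp only [HypSpace.coord_symm_apply, Fin.snoc_castSucc]
      fun_prop
  have h2 : ContMDiff (𝓡 n) (𝓡 n) ∞ (HypSpace.coord n) :=
    contMDiff_isOpenEmbedding (HypSpace.coord n).isOpenEmbedding
  have := h1.contMDiff.comp h2
  have h3 : (fun x : HypSpace n => (x : Fin (n + 1) → ℝ)) =
      (fun y => (((HypSpace.coord n).symm y : HypSpace n) : Fin (n + 1) → ℝ)) ∘
        (HypSpace.coord n) := by
    funext x; simp
  rw [h3]; exact this

theorem HypSpace.contMDiff_of_val {n : ℕ} {f : HypSpace n → HypSpace n}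
    (hf : ContMDiff (𝓡 n) 𝓘(ℝ, Fin (n + 1) → ℝ) ∞ (fun x => (f x : Fin (n + 1) → ℝ))) :
    ContMDiff (𝓡 n) (𝓡 n) ∞ f := by
  have h1 : ContMDiff (𝓡 n) (𝓡 n) ∞ (fun x => HypSpace.coord n (f x)) := by
    have : ContDiff ℝ ∞ (fun x : Fin (n + 1) → ℝ =>
      (WithLp.toLp 2 (fun i : Fin n => x i.castSucc) : EuclideanSpace ℝ (Fin n))) := by fun_prop
    exact this.contMDiff.comp hf
  exact ContMDiff.of_comp_isOpenEmbedding (HypSpace.coord n).isOpenEmbedding h1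

/-- The group `G = SL(n+1, ℝ)`. -/
abbrev SL (n : ℕ) : Type := Matrix.SpecialLinearGroup (Fin (n + 1)) ℝ

theorem SL.mulVec_inv {n : ℕ} (A : SL n) (x : Fin (n + 1) → ℝ) :
    A.1 *ᵥ ((A⁻¹ : SL n).1 *ᵥ x) = x := by
  rw [Matrix.mulVec_mulVec, ← Matrix.SpecialLinearGroup.coe_mul, mul_inv_cancel]
  simp

/-- `SO(n, 1)`: the elements of `SL(n+1, ℝ)` preserving the Lorentzian form. -/
def SO (n : ℕ) : Subgroup (SL n) where
  carrier := {A | ∀ x y : Fin (n + 1) → ℝ, lorentz (A.1 *ᵥ x) (A.1 *ᵥ y) = lorentz x y}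
  one_mem' := by intro x y; simp
  mul_mem' := by
    intro A B hA hB x y
    simp only [Matrix.SpecialLinearGroup.coe_mul, ← Matrix.mulVec_mulVec]
    rw [hA, hB]
  inv_mem' := by
    intro A hA x y
    rw [← hA, SL.mulVec_inv, SL.mulVec_inv]

/-- `SO_o(n, 1)`: the elements of `SO(n, 1)` preserving the positive sheet of the hyperboloid,
that is, the orientation-preserving isometries of `ℍⁿ`. -/
def SOo (n : ℕ) : Subgroup (SL n) where
  carrier := {A | A ∈ SO n ∧ ∀ x : Fin (n + 1) → ℝ, A.1 *ᵥ x ∈ sheet n ↔ x ∈ sheet n}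
  one_mem' := ⟨one_mem _, by intro x; simp⟩
  mul_mem' := by
    rintro A B ⟨hA, hA'⟩ ⟨hB, hB'⟩
    refine ⟨mul_mem hA hB, fun x => ?_⟩
    rw [Matrix.SpecialLinearGroup.coe_mul, ← Matrix.mulVec_mulVec, hA', hB']
  inv_mem' := by
    rintro A ⟨hA, hA'⟩
    refine ⟨inv_mem hA, fun x => ?_⟩
    rw [← hA', SL.mulVec_inv]

theorem SOo_le_SO (n : ℕ) : SOo n ≤ SO n := fun _ h => h.1

/-- The linear action of `SO_o(n, 1)` on the hyperboloid sheet `ℍⁿ`. -/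
instance (n : ℕ) : MulAction (SOo n) (HypSpace n) where
  smul A x := ⟨A.1.1 *ᵥ x.1, (A.2.2 x.1).2 x.2⟩
  one_smul x := HypSpace.ext (by change (1 : SL n).1 *ᵥ x.1 = x.1; simp)
  mul_smul A B x := HypSpace.ext (by
    change (A.1 * B.1).1 *ᵥ x.1 = A.1.1 *ᵥ (B.1.1 *ᵥ x.1)
    rw [Matrix.SpecialLinearGroup.coe_mul, Matrix.mulVec_mulVec])

theorem SOo.coe_smul {n : ℕ} (A : SOo n) (x : HypSpace n) :
    ((A • x : HypSpace n) : Fin (n + 1) → ℝ) = A.1.1 *ᵥ x.1 := rfl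

theorem SOo.contMDiff_smul {n : ℕ} (A : SOo n) :
    ContMDiff (𝓡 n) (𝓡 n) ∞ (fun x : HypSpace n => A • x) := by
  apply HypSpace.contMDiff_of_val
  have : ContDiff ℝ ∞ (fun x : Fin (n + 1) → ℝ => A.1.1 *ᵥ x) :=
    (LinearMap.toContinuousLinearMap (Matrix.mulVecLin A.1.1)).contDiff
  exact this.contMDiff.comp (HypSpace.contMDiff_val n)

/-- The hypotheses on the group: `Γ ⊂ SO_o(n, 1)` is discrete and torsion-free. -/
class IsTorsionFreeDiscrete {n : ℕ} (Γ : Subgroup (SOo n)) : Prop where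
  discrete : DiscreteTopology Γ
  torsionFree : ∀ γ : Γ, IsOfFinOrder γ → γ = 1

/-! ### Proper discontinuity -/

theorem lorentz_add_smul {n : ℕ} (x z : Fin (n + 1) → ℝ) (c : ℝ) :
    lorentz (c • x - z) (c • x - z) =
      c ^ 2 * lorentz x x - 2 * c * lorentz x z + lorentz z z := by
  simp only [lorentz, Pi.sub_apply, Pi.smul_apply, smul_eq_mul]
  have : ∀ i : Fin n, (c * x i.castSucc - z i.castSucc) * (c * x i.castSucc - z i.castSucc) =
      c ^ 2 * (x i.castSucc * x i.castSucc) - 2 * c * (x i.castSucc * z i.castSucc)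
        + z i.castSucc * z i.castSucc := fun i => by ring
  simp only [this, Finset.sum_add_distrib, Finset.sum_sub_distrib, ← Finset.mul_sum]
  ring

theorem sheet_sq_le {n : ℕ} {x : Fin (n + 1) → ℝ} (hx : x ∈ sheet n) (i : Fin (n + 1)) :
    |x i| ≤ x (Fin.last n) := by
  refine Fin.lastCases ?_ (fun j => ?_) i
  · exact (abs_of_pos hx.2).le
  · have h1 := hx.1
    simp only [lorentz] at h1
    have h2 : x j.castSucc * x j.castSucc ≤ ∑ i : Fin n, x i.castSucc * x i.castSucc :=
      Finset.single_le_sum (f := fun i : Fin n => x i.castSucc * x i.castSucc)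
        (fun i _ => mul_self_nonneg _) (Finset.mem_univ j)
    exact abs_le_of_sq_le_sq (by nlinarith) hx.2.le

theorem neg_lorentz_le {n : ℕ} {x z : Fin (n + 1) → ℝ} (hx : x ∈ sheet n) (hz : z ∈ sheet n) :
    1 ≤ - lorentz x z := by
  have h1 := hx.1
  have h2 := hz.1
  simp only [lorentz] at h1 h2 ⊢
  have h3 := Finset.sum_mul_sq_le_sq_mul_sq Finset.univ (fun i : Fin n => x i.castSucc)
    (fun i => z i.castSucc)
  simp only [← pow_two] at h1 h2
  set a := ∑ i : Fin n, x i.castSucc ^ 2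
  set b := ∑ i : Fin n, z i.castSucc ^ 2
  set c := ∑ i : Fin n, x i.castSucc * z i.castSucc
  have hx2 := hx.2
  have hz2 := hz.2
  set s := x (Fin.last n)
  set t := z (Fin.last n)
  have ha : a = s ^ 2 - 1 := by linarith
  have hb : b = t ^ 2 - 1 := by linarith
  rw [ha, hb] at h3
  have hs1 : 0 ≤ a := Finset.sum_nonneg fun i _ => sq_nonneg _
  have ht1 : 0 ≤ b := Finset.sum_nonneg fun i _ => sq_nonneg _
  have hst : 1 ≤ s * t := by
    have : 1 ≤ s := by nlinarith
    have : 1 ≤ t := by nlinarith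
    nlinarith
  have : c ≤ s * t - 1 := by
    refine le_of_sq_le_sq' ?_ (by linarith)
    nlinarith [sq_nonneg (s - t)]
  linarith
where
  le_of_sq_le_sq' {a b : ℝ} (h : a ^ 2 ≤ b ^ 2) (hb : 0 ≤ b) : a ≤ b := abs_le_of_sq_le_sq' h hb |>.2


theorem reflect_mem_sheet {n : ℕ} {x z : Fin (n + 1) → ℝ} (hx : x ∈ sheet n) (hz : z ∈ sheet n) :
    (-2 * lorentz x z) • x - z ∈ sheet n := by
  have h0 : lorentz ((-2 * lorentz x z) • x - z) ((-2 * lorentz x z) • x - z) = -1 := by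
    rw [lorentz_add_smul, hx.1, hz.1]; ring
  refine ⟨h0, ?_⟩
  by_contra hneg
  push Not at hneg
  set w := (-2 * lorentz x z) • x - z with hw
  have hne : w (Fin.last n) ≠ 0 := by
    intro h
    simp only [lorentz, h] at h0
    have : 0 ≤ ∑ i : Fin n, w i.castSucc * w i.castSucc :=
      Finset.sum_nonneg fun i _ => mul_self_nonneg _
    linarith
  have hw' : -w ∈ sheet n := by
    refine ⟨?_, by simpa using lt_of_le_of_ne hneg hne⟩
    rw [← h0]; simp [lorentz]
  have h1 := neg_lorentz_le hx hw'
  have h2 := neg_lorentz_le hx hz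
  have h3 : lorentz x (-w) = - lorentz x z := by
    have : lorentz x (-w) = 2 * lorentz x z * lorentz x x + lorentz x z := by
      simp only [hw, lorentz, Pi.neg_apply, Pi.sub_apply, Pi.smul_apply, smul_eq_mul]
      set c := ∑ i : Fin n, x i.castSucc * z i.castSucc - x (Fin.last n) * z (Fin.last n)
      have h4 : ∀ i : Fin n, x i.castSucc * -(-2 * c * x i.castSucc - z i.castSucc) =
        2 * c * (x i.castSucc * x i.castSucc) + x i.castSucc * z i.castSucc := fun i => by ring
      simp only [h4, Finset.sum_add_distrib, ← Finset.mul_sum]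
      ring
    rw [this, hx.1]; ring
  linarith

theorem neg_lorentz_le_mul {n : ℕ} {x z : Fin (n + 1) → ℝ} (hx : x ∈ sheet n)
    (hz : z ∈ sheet n) : - lorentz x z ≤ (n + 1) * (x (Fin.last n) * z (Fin.last n)) := by
  have h : - ∑ i : Fin n, x i.castSucc * z i.castSucc ≤
      ∑ _i : Fin n, x (Fin.last n) * z (Fin.last n) := by
    rw [← Finset.sum_neg_distrib]
    refine Finset.sum_le_sum fun i _ => ?_
    refine (neg_le_abs _).trans ?_
    rw [abs_mul]
    exact mul_le_mul (sheet_sq_le hx _) (sheet_sq_le hz _) (abs_nonneg _) hx.2.le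
  simp only [Finset.sum_const, Finset.card_univ, Fintype.card_fin, nsmul_eq_mul] at h
  simp only [lorentz]
  linarith

theorem SOo.entry_bound {n : ℕ} (A : SOo n) (x : HypSpace n) (i j : Fin (n + 1)) :
    |A.1.1 i j| ≤ 8 * (n + 1) * (x.1 (Fin.last n) * (A • x).1 (Fin.last n)) := by
  have key : ∀ z ∈ sheet n, ∀ i, |(A.1.1 *ᵥ z) i| ≤
      2 * (n + 1) * (x.1 (Fin.last n) * (A • x).1 (Fin.last n)) * z (Fin.last n) := by
    intro z hz i
    have hAz := (A.2.2 z).2 hz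
    refine (sheet_sq_le hAz i).trans ?_
    have h1 := ((A.2.2 _).2 (reflect_mem_sheet x.2 hz)).2
    rw [Matrix.mulVec_sub, Matrix.mulVec_smul] at h1
    simp only [Pi.sub_apply, Pi.smul_apply, smul_eq_mul] at h1
    have h2 := neg_lorentz_le_mul x.2 hz
    have h3 := (A • x).2.2
    rw [SOo.coe_smul] at h3 ⊢
    nlinarith
  have hpos : 0 < x.1 (Fin.last n) * (A • x).1 (Fin.last n) := mul_pos x.2.2 (A • x).2.2
  set R := x.1 (Fin.last n) * (A • x).1 (Fin.last n)
  have hn : (0 : ℝ) ≤ n := Nat.cast_nonneg n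
  have he : (Pi.single (Fin.last n) 1 : Fin (n + 1) → ℝ) ∈ sheet n := by
    constructor <;> simp [lorentz]
  have hlast : ∀ i, |A.1.1 i (Fin.last n)| ≤ 2 * (n + 1) * R := by
    intro i
    simpa using key _ he i
  have hR : 0 ≤ (n + 1) * R := by positivity
  refine Fin.lastCases ?_ (fun j => ?_) j
  · refine (hlast i).trans ?_
    nlinarith
  · have hz : (Pi.single j.castSucc 1 + √2 • Pi.single (Fin.last n) 1 : Fin (n + 1) → ℝ)
        ∈ sheet n := by
      constructor
      · have : ∀ i : Fin n, (Pi.single j.castSucc (1 : ℝ) : Fin (n + 1) → ℝ) i.castSucc =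
            if i = j then 1 else 0 := fun i => by simp [Pi.single_apply]
        simp [lorentz, this]
        norm_num
      · simp
    have h1 := key _ hz i
    rw [Matrix.mulVec_add, Matrix.mulVec_smul] at h1
    simp at h1
    have h2 := hlast i
    have h3 : √2 ≤ 3 / 2 := by
      rw [Real.sqrt_le_left (by norm_num)]; norm_num
    have h4 : (0 : ℝ) ≤ √2 := Real.sqrt_nonneg _
    have h5 : |√2 * A.1.1 i (Fin.last n)| ≤ 3 / 2 * (2 * (n + 1) * R) := by
      rw [abs_mul, abs_of_nonneg h4]
      exact mul_le_mul h3 h2 (abs_nonneg _) (by norm_num)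
    have h6 : |A.1.1 i j.castSucc| ≤ |A.1.1 i j.castSucc + √2 * A.1.1 i (Fin.last n)| +
        |√2 * A.1.1 i (Fin.last n)| := by
      have := abs_sub (A.1.1 i j.castSucc + √2 * A.1.1 i (Fin.last n))
        (√2 * A.1.1 i (Fin.last n))
      simpa using this
    nlinarith

instance {n : ℕ} : ContinuousConstSMul (SOo n) (HypSpace n) :=
  ⟨fun A => (SOo.contMDiff_smul A).continuous⟩

instance {n : ℕ} (Γ : Subgroup (SOo n)) : ContinuousConstSMul Γ (HypSpace n) :=
  ⟨fun A => (SOo.contMDiff_smul A.1).continuous⟩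

/-- A discrete group of isometries acts properly discontinuously on `ℍⁿ`. -/
instance {n : ℕ} (Γ : Subgroup (SOo n)) [hΓ : IsTorsionFreeDiscrete Γ] :
    ProperlyDiscontinuousSMul Γ (HypSpace n) where
  finite_disjoint_inter_image := by
    intro K L hK hL
    have hcont : Continuous fun x : HypSpace n => x.1 (Fin.last n) :=
      (continuous_apply _).comp HypSpace.continuous_val
    obtain ⟨a, ha⟩ := hK.bddAbove_image hcont.continuousOn
    obtain ⟨b, hb⟩ := hL.bddAbove_image hcont.continuousOn
    set R := 8 * (n + 1) * (a * b)
    let f : Γ → SL n := fun γ => γ.1.1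
    have hf : IsEmbedding f := IsEmbedding.subtypeVal.comp IsEmbedding.subtypeVal
    let Γ' : Subgroup (SL n) := Γ.map (SOo n).subtype
    have hrange : Set.range f = Γ' := by
      ext A; simp [f, Γ']
    have : DiscreteTopology Γ := hΓ.discrete
    have hdisc : DiscreteTopology Γ' := by
      have e : Γ ≃ₜ Set.range f := hf.toHomeomorph
      have : DiscreteTopology (Set.range f) := e.symm.isEmbedding.discreteTopology
      rw [hrange] at this
      exact this
    have hclosed : IsClosed (Γ' : Set (SL n)) := Subgroup.isClosed_of_discrete
    let C : Set (SL n) := {A | ∀ i j, A.1 i j ∈ Set.Icc (-R) R}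
    have hC : IsCompact C := by
      have h1 : IsCompact {A : Matrix (Fin (n + 1)) (Fin (n + 1)) ℝ | ∀ i j, A i j ∈ Set.Icc (-R) R} := by
        have := isCompact_univ_pi (fun _ : Fin (n + 1) =>
          isCompact_univ_pi (fun _ : Fin (n + 1) => isCompact_Icc (a := -R) (b := R)))
        refine (congrArg IsCompact (Set.ext fun A => ?_)).mp this
        exact ⟨fun h i j => h i trivial j trivial, fun h i _ j _ => h i j⟩
      exact Matrix.SpecialLinearGroup.isClosedEmbedding_val.isCompact_preimage h1
    have hfin : (C ∩ Γ').Finite := by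
      have h2 : IsCompact (C ∩ (Γ' : Set (SL n))) := hC.inter_right hclosed
      refine h2.finite ?_
      exact IsDiscrete.mono ⟨hdisc⟩ Set.inter_subset_right
    refine (hfin.preimage (f := f) hf.injective.injOn).subset ?_
    intro γ hγ
    obtain ⟨y, ⟨x, hx, hxy⟩, hy⟩ := hγ
    refine ⟨fun i j => ?_, ?_⟩
    · refine abs_le.1 ?_
      refine (SOo.entry_bound γ.1 x i j).trans ?_
      have h1 : x.1 (Fin.last n) ≤ a := ha ⟨x, hx, rfl⟩
      have h2 : (γ.1 • x).1 (Fin.last n) ≤ b := hb ⟨y, hy, by rw [← hxy]; rfl⟩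
      have h3 := x.2.2
      have h4 := (γ.1 • x).2.2
      have : x.1 (Fin.last n) * (γ.1 • x).1 (Fin.last n) ≤ a * b :=
        mul_le_mul h1 h2 h4.le (h3.le.trans h1)
      exact mul_le_mul_of_nonneg_left this (by positivity)
    · rw [← hrange]; exact ⟨γ, rfl⟩

/-- A torsion-free discrete group of isometries acts freely on `ℍⁿ`. -/
instance {n : ℕ} (Γ : Subgroup (SOo n)) [hΓ : IsTorsionFreeDiscrete Γ] :
    IsCancelSMul Γ (HypSpace n) := by
  rw [isCancelSMul_iff_eq_one_of_smul_eq]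
  intro γ x hx
  apply hΓ.torsionFree
  have hfin := ProperlyDiscontinuousSMul.finite_stabilizer' Γ x
  have : Finite (MulAction.stabilizer Γ x) := hfin
  have h := isOfFinOrder_of_finite (⟨γ, hx⟩ : MulAction.stabilizer Γ x)
  exact (MulAction.stabilizer Γ x).subtype.isOfFinOrder h

/-! ### The quotient manifold -/

/-- The hyperbolic manifold `M = Γ \ ℍⁿ`. It carries the quotient topology, and the charts that are
local inverses of the projection `ℍⁿ → M` followed by charts of `ℍⁿ`. -/
abbrev QuotMfd {n : ℕ} (Γ : Subgroup (SOo n)) : Type := MulAction.orbitRel.Quotient Γ (HypSpace n)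

section Quotient

variable {n : ℕ} (Γ : Subgroup (SOo n))

/-- The projection `ℍⁿ → M`. -/
def quotProj (x : HypSpace n) : QuotMfd Γ := Quotient.mk _ x

theorem quotProj_surjective : Function.Surjective (quotProj Γ) := Quotient.mk_surjective

theorem quotProj_eq_iff {x y : HypSpace n} :
    quotProj Γ x = quotProj Γ y ↔ ∃ γ : Γ, γ • y = x := by
  rw [quotProj, quotProj, Quotient.eq]
  exact MulAction.orbitRel_apply

theorem quotProj_smul (γ : Γ) (x : HypSpace n) : quotProj Γ (γ • x) = quotProj Γ x :=
  (quotProj_eq_iff Γ).2 ⟨γ, rfl⟩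

variable [hΓ : IsTorsionFreeDiscrete Γ]

theorem quotProj_isLocalHomeomorph : IsLocalHomeomorph (quotProj Γ) :=
  isQuotientCoveringMap_quotientMk_of_properlyDiscontinuousSMul.isCoveringMap.isLocalHomeomorph

/-- The local section of `ℍⁿ → M` through `x`. -/
def localSec (x : HypSpace n) : OpenPartialHomeomorph (QuotMfd Γ) (HypSpace n) :=
  (quotProj_isLocalHomeomorph Γ).localInverseAt x

theorem localSec_mem (x : HypSpace n) : quotProj Γ x ∈ (localSec Γ x).source :=
  (quotProj_isLocalHomeomorph Γ).apply_self_mem_localInverseAt_source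

theorem localSec_self (x : HypSpace n) : localSec Γ x (quotProj Γ x) = x :=
  (quotProj_isLocalHomeomorph Γ).localInverseAt_apply_self

theorem quotProj_localSec (x : HypSpace n) {m : QuotMfd Γ} (hm : m ∈ (localSec Γ x).source) :
    quotProj Γ (localSec Γ x m) = m :=
  (quotProj_isLocalHomeomorph Γ).apply_localInverseAt_of_mem hm

theorem localSec_symm_apply (x y : HypSpace n) : (localSec Γ x).symm y = quotProj Γ y := by
  have := (quotProj_isLocalHomeomorph Γ).localInverseAt_symm (x := x)
  exact congrFun this y

/-- Two local sections differ by a locally constant element of `Γ`. -/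
theorem localSec_change (x y : HypSpace n) {m : QuotMfd Γ} (hx : m ∈ (localSec Γ x).source)
    (hy : m ∈ (localSec Γ y).source) :
    ∃ γ : Γ, ∀ᶠ m' in 𝓝 m, localSec Γ y m' = γ • localSec Γ x m' := by
  obtain ⟨γ, hγ⟩ : ∃ γ : Γ, γ • localSec Γ x m = localSec Γ y m := by
    rw [← quotProj_eq_iff, quotProj_localSec Γ x hx, quotProj_localSec Γ y hy]
  refine ⟨γ, ?_⟩
  have hcx : ContinuousAt (localSec Γ x) m := (localSec Γ x).continuousAt hx
  have hc : ContinuousAt (fun m' => γ • localSec Γ x m') m := hcx.const_smul γ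
  have h1 : ∀ᶠ m' in 𝓝 m, γ • localSec Γ x m' ∈ (localSec Γ y).target := by
    refine hc.eventually_mem ?_
    rw [hγ]
    exact (localSec Γ y).open_target.mem_nhds ((localSec Γ y).map_source hy)
  filter_upwards [h1, (localSec Γ x).open_source.mem_nhds hx,
    (localSec Γ y).open_source.mem_nhds hy] with m' h1 h2 h3
  refine (localSec Γ y).symm.injOn ((localSec Γ y).map_source h3) h1 ?_
  rw [localSec_symm_apply, localSec_symm_apply, quotProj_smul, quotProj_localSec Γ x h2,
    quotProj_localSec Γ y h3]

theorem chart_eq (e : OpenPartialHomeomorph (QuotMfd Γ) (EuclideanSpace ℝ (Fin n)))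
    (he : e ∈ atlas (EuclideanSpace ℝ (Fin n)) (QuotMfd Γ)) :
    ∃ x : HypSpace n, e = (localSec Γ x).trans (chartAt (EuclideanSpace ℝ (Fin n)) x) := by
  obtain ⟨q, rfl⟩ := he
  exact ⟨_, rfl⟩

theorem HypSpace.contMDiffOn_chartAt (x : HypSpace n) :
    ContMDiff (𝓡 n) (𝓡 n) ∞ (chartAt (EuclideanSpace ℝ (Fin n)) x) := by
  have h := contMDiffOn_chart (I := 𝓡 n) (n := ∞) (x := x)
  exact contMDiffOn_univ.1 h

theorem HypSpace.contMDiffOn_chartAt_symm (x : HypSpace n) :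
    ContMDiff (𝓡 n) (𝓡 n) ∞ (chartAt (EuclideanSpace ℝ (Fin n)) x).symm := by
  have h := contMDiffOn_chart_symm (I := 𝓡 n) (n := ∞) (x := x)
  have h2 : (chartAt (EuclideanSpace ℝ (Fin n)) x).target = univ :=
    Set.image_univ.trans (HypSpace.coord n).surjective.range_eq
  rw [h2] at h
  exact contMDiffOn_univ.1 h

instance : IsManifold (𝓡 n) ∞ (QuotMfd Γ) := by
  refine isManifold_of_contDiffOn _ _ _ ?_
  intro e e' he he'
  obtain ⟨x, rfl⟩ := chart_eq Γ e he
  obtain ⟨y, rfl⟩ := chart_eq Γ e' he'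
  intro u hu
  refine ContDiffAt.contDiffWithinAt ?_
  simp only [modelWithCornersSelf_coe, modelWithCornersSelf_coe_symm, Function.comp_def, id,
    Set.preimage_id, Set.range_id, Set.inter_univ, OpenPartialHomeomorph.trans_source, OpenPartialHomeomorph.symm_source,
    OpenPartialHomeomorph.coe_trans, OpenPartialHomeomorph.coe_trans_symm, Set.mem_inter_iff, Set.mem_preimage] at hu ⊢
  set cx := chartAt (EuclideanSpace ℝ (Fin n)) x
  set cy := chartAt (EuclideanSpace ℝ (Fin n)) y
  set z := cx.symm u
  have hz : z ∈ (localSec Γ x).target := hu.1.2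
  have hxm : quotProj Γ z ∈ (localSec Γ x).source := by
    rw [← localSec_symm_apply Γ x]; exact (localSec Γ x).map_target hz
  have hym : quotProj Γ z ∈ (localSec Γ y).source := by
    rw [← localSec_symm_apply Γ x]; exact hu.2.1
  obtain ⟨γ, hγ⟩ := localSec_change Γ x y hxm hym
  have hsm : ContMDiff (𝓡 n) (𝓡 n) ∞ (fun w => cy (γ • cx.symm w)) :=
    (HypSpace.contMDiffOn_chartAt y).comp
      ((SOo.contMDiff_smul γ.1).comp (HypSpace.contMDiffOn_chartAt_symm x))
  refine (contMDiff_iff_contDiff.1 hsm).contDiffAt.congr_of_eventuallyEq ?_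
  have hc : ContinuousAt cx.symm u := (HypSpace.contMDiffOn_chartAt_symm x).continuous.continuousAt
  have hc2 : ContinuousAt (quotProj Γ) z := (quotProj_isLocalHomeomorph Γ).continuous.continuousAt
  filter_upwards [hc.eventually (hc2.eventually hγ),
    hc.eventually ((localSec Γ x).open_target.mem_nhds hz)] with w hw1 hw2
  rw [localSec_symm_apply, hw1, ← localSec_symm_apply Γ x, (localSec Γ x).right_inv hw2]

theorem chartAt_eq (m : QuotMfd Γ) : ∃ x : HypSpace n, chartAt (EuclideanSpace ℝ (Fin n)) m =
    (localSec Γ x).trans (chartAt (EuclideanSpace ℝ (Fin n)) x) :=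
  chart_eq Γ _ (chart_mem_atlas _ _)

theorem localSec_contMDiffOn (x : HypSpace n) :
    ContMDiffOn (𝓡 n) (𝓡 n) ∞ (localSec Γ x) (localSec Γ x).source := by
  intro m hm
  refine ContMDiffAt.contMDiffWithinAt ?_
  obtain ⟨y, hy⟩ := chartAt_eq Γ m
  have hm' : m ∈ (chartAt (EuclideanSpace ℝ (Fin n)) m).source := mem_chart_source _ m
  rw [hy] at hm'
  have hym : m ∈ (localSec Γ y).source := hm'.1
  obtain ⟨γ, hγ⟩ := localSec_change Γ y x hym hm
  have h1 : ContMDiffAt (𝓡 n) (𝓡 n) ∞ (chartAt (EuclideanSpace ℝ (Fin n)) m) m :=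
    contMDiffAt_of_mem_maximalAtlas (IsManifold.chart_mem_maximalAtlas m) (mem_chart_source _ m)
  have h2 : ContMDiffAt (𝓡 n) (𝓡 n) ∞ (fun m' => γ •
      (chartAt (EuclideanSpace ℝ (Fin n)) y).symm (chartAt (EuclideanSpace ℝ (Fin n)) m m')) m :=
    ((SOo.contMDiff_smul γ.1).comp (HypSpace.contMDiffOn_chartAt_symm y)).contMDiffAt.comp m h1
  refine h2.congr_of_eventuallyEq ?_
  filter_upwards [hγ] with m' h
  rw [h, hy, OpenPartialHomeomorph.coe_trans, Function.comp_apply,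
    (chartAt (EuclideanSpace ℝ (Fin n)) y).left_inv trivial]

theorem quotProj_contMDiff : ContMDiff (𝓡 n) (𝓡 n) ∞ (quotProj Γ) := by
  intro x
  set m := quotProj Γ x
  obtain ⟨y, hy⟩ := chartAt_eq Γ m
  have hm' : m ∈ (chartAt (EuclideanSpace ℝ (Fin n)) m).source := mem_chart_source _ m
  rw [hy] at hm'
  have hym : m ∈ (localSec Γ y).source := hm'.1
  obtain ⟨γ, hγ⟩ : ∃ γ : Γ, γ • x = localSec Γ y m := by
    rw [← quotProj_eq_iff, quotProj_localSec Γ y hym]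
  have h1 : ContMDiffAt (𝓡 n) (𝓡 n) ∞ (chartAt (EuclideanSpace ℝ (Fin n)) m).symm
      (chartAt (EuclideanSpace ℝ (Fin n)) y (γ • x)) := by
    refine contMDiffAt_symm_of_mem_maximalAtlas (IsManifold.chart_mem_maximalAtlas m) ?_
    have : chartAt (EuclideanSpace ℝ (Fin n)) y (γ • x) =
        chartAt (EuclideanSpace ℝ (Fin n)) m m := by rw [hy, hγ]; rfl
    rw [this]
    exact mem_chart_target _ m
  have h2 : ContMDiffAt (𝓡 n) (𝓡 n) ∞ (fun x' => (chartAt (EuclideanSpace ℝ (Fin n)) m).symm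
      (chartAt (EuclideanSpace ℝ (Fin n)) y (γ • x'))) x :=
    h1.comp x ((HypSpace.contMDiffOn_chartAt y).comp (SOo.contMDiff_smul γ.1)).contMDiffAt
  refine h2.congr_of_eventuallyEq (Filter.Eventually.of_forall fun x' => ?_)
  simp only [hy]
  rw [OpenPartialHomeomorph.coe_trans_symm, Function.comp_apply,
    (chartAt (EuclideanSpace ℝ (Fin n)) y).left_inv trivial, localSec_symm_apply, quotProj_smul]

end Quotient

/-! ### Vector bundles on `M` -/

universe u

/-- A smooth vector bundle on `M = Γ \ ℍⁿ` with typical fibre `V`, given by its set-theoretic total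
space `Total → M` and a global smooth frame of its pull-back to `ℍⁿ`: `frame x` identifies `V` with
the fibre over the image of `x`, and the frames at `x` and `γ • x` differ by a linear map depending
smoothly on `x`. -/
structure DescendedBundle {n : ℕ} (Γ : Subgroup (SOo n)) (V : Type u) [NormedAddCommGroup V]
    [NormedSpace ℝ V] where
  Total : Type u
  proj : Total → QuotMfd Γ
  frame : HypSpace n → V → Total
  proj_frame : ∀ x v, proj (frame x v) = quotProj Γ x
  existsUnique_frame : ∀ q x, proj q = quotProj Γ x → ∃! v, frame x v = q
  change : Γ → HypSpace n → V →L[ℝ] V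
  frame_smul : ∀ γ x v, frame (γ • x) (change γ x v) = frame x v
  contMDiff_change : ∀ γ, ContMDiff (𝓡 n) 𝓘(ℝ, V →L[ℝ] V) ∞ (change γ)

namespace DescendedBundle

variable {n : ℕ} {Γ : Subgroup (SOo n)} {V : Type u} [NormedAddCommGroup V] [NormedSpace ℝ V]
  (D : DescendedBundle Γ V)

/-- The fibre of the total space over `m`. -/
def Fib (m : QuotMfd Γ) : Type u := {q : D.Total // D.proj q = m}

/-- The identification of `V` with the fibre over the image of `x`. -/
def fibEquiv (x : HypSpace n) (m : QuotMfd Γ) (h : quotProj Γ x = m) : V ≃ D.Fib m :=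
  Equiv.ofBijective (fun v => ⟨D.frame x v, (D.proj_frame x v).trans h⟩) (by
    subst h
    constructor
    · intro v w hvw
      have h1 : D.frame x v = D.frame x w := congrArg Subtype.val hvw
      exact (D.existsUnique_frame (D.frame x w) x (D.proj_frame x w)).unique h1 rfl
    · rintro ⟨q, hq⟩
      obtain ⟨v, hv, -⟩ := D.existsUnique_frame q x hq
      exact ⟨v, Subtype.ext hv⟩)

theorem fibEquiv_coe (x : HypSpace n) (m : QuotMfd Γ) (h : quotProj Γ x = m) (v : V) :
    (D.fibEquiv x m h v).1 = D.frame x v := rfl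

/-- A lift of `m` to `ℍⁿ`. -/
def lift (m : QuotMfd Γ) : HypSpace n := (quotProj_surjective Γ m).choose

theorem quotProj_lift (m : QuotMfd Γ) : quotProj Γ (lift m) = m :=
  (quotProj_surjective Γ m).choose_spec

/-- The vector space structure of the fibres; it makes all the frames linear. -/
instance (m : QuotMfd Γ) : AddCommGroup (D.Fib m) :=
  (D.fibEquiv (lift m) m (quotProj_lift m)).symm.addCommGroup

instance (m : QuotMfd Γ) : Module ℝ (D.Fib m) :=
  (D.fibEquiv (lift m) m (quotProj_lift m)).symm.module ℝ

instance (m : QuotMfd Γ) : TopologicalSpace (D.Fib m) :=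
  TopologicalSpace.induced (D.fibEquiv (lift m) m (quotProj_lift m)).symm inferInstance

/-- The linear identification of `V` with the fibre given by the preferred lift. -/
def fibLin₀ (m : QuotMfd Γ) : D.Fib m ≃ₗ[ℝ] V :=
  (D.fibEquiv (lift m) m (quotProj_lift m)).symm.linearEquiv ℝ

instance (m : QuotMfd Γ) : IsTopologicalAddGroup (D.Fib m) :=
  topologicalAddGroup_induced (D.fibLin₀ m)

instance (m : QuotMfd Γ) : ContinuousSMul ℝ (D.Fib m) :=
  continuousSMul_induced (D.fibLin₀ m)

theorem fibEquiv_change (x : HypSpace n) (m : QuotMfd Γ) (h : quotProj Γ x = m) (γ : Γ)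
    (v : V) : D.fibEquiv (γ • x) m ((quotProj_smul Γ γ x).trans h) (D.change γ x v) =
      D.fibEquiv x m h v :=
  Subtype.ext (D.frame_smul γ x v)

theorem exists_change (x y : HypSpace n) (m : QuotMfd Γ) (hx : quotProj Γ x = m)
    (hy : quotProj Γ y = m) :
    ∃ L : V →L[ℝ] V, ∀ v, D.fibEquiv y m hy (L v) = D.fibEquiv x m hx v := by
  obtain ⟨γ, rfl⟩ := (quotProj_eq_iff Γ).1 (hy.trans hx.symm)
  exact ⟨D.change γ x, fun v => D.fibEquiv_change x m hx γ v⟩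

/-- The linear homeomorphism of `V` with the fibre over the image of `x`, given by the frame. -/
def fibLin (x : HypSpace n) (m : QuotMfd Γ) (h : quotProj Γ x = m) : V ≃L[ℝ] D.Fib m :=
  have key : ∃ L : V →L[ℝ] V, ∀ v, D.fibEquiv x m h v = (D.fibLin₀ m).symm (L v) := by
    obtain ⟨L, hL⟩ := D.exists_change x (lift m) m h (quotProj_lift m)
    exact ⟨L, fun v => (hL v).symm⟩
  have key' : ∃ L : V →L[ℝ] V, ∀ f, (D.fibEquiv x m h).symm f = L (D.fibLin₀ m f) := by
    obtain ⟨L, hL⟩ := D.exists_change (lift m) x m (quotProj_lift m) h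
    refine ⟨L, fun f => ?_⟩
    rw [Equiv.symm_apply_eq, hL]
    exact ((D.fibLin₀ m).symm_apply_apply f).symm
  have hcont : Continuous (D.fibLin₀ m) := continuous_induced_dom
  have hcont' : Continuous (D.fibLin₀ m).symm := by
    refine continuous_induced_rng.2 ?_
    have : (D.fibEquiv (lift m) m (quotProj_lift m)).symm ∘ (D.fibLin₀ m).symm = id :=
      funext fun v => (D.fibLin₀ m).apply_symm_apply v
    rw [this]; exact continuous_id
  { D.fibEquiv x m h with
    map_add' := by
      obtain ⟨L, hL⟩ := key
      intro v w
      simp [hL]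
    map_smul' := by
      obtain ⟨L, hL⟩ := key
      intro c v
      simp [hL]
    continuous_toFun := by
      obtain ⟨L, hL⟩ := key
      exact (hcont'.comp L.continuous).congr fun v => (hL v).symm
    continuous_invFun := by
      obtain ⟨L, hL⟩ := key'
      exact (L.continuous.comp hcont).congr fun v => (hL v).symm }

theorem fibLin_coe (x : HypSpace n) (m : QuotMfd Γ) (h : quotProj Γ x = m) (v : V) :
    (D.fibLin x m h v).1 = D.frame x v := rfl

theorem fibLin_change (x : HypSpace n) (m : QuotMfd Γ) (h : quotProj Γ x = m) (γ : Γ)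
    (h' : quotProj Γ (γ • x) = m) (v : V) :
    D.fibLin (γ • x) m h' (D.change γ x v) = D.fibLin x m h v :=
  D.fibEquiv_change x m h γ v

/-- The representation of a section `s` in the frame: the function `ℍⁿ → V` whose value at `x` is
the coordinate vector of `s` at the image of `x`. -/
def coords (s : Π m, D.Fib m) (x : HypSpace n) : V :=
  (D.fibLin x (quotProj Γ x) rfl).symm (s (quotProj Γ x))

theorem coords_add (s t : Π m, D.Fib m) : D.coords (s + t) = D.coords s + D.coords t := by
  funext x; simp [coords]

theorem coords_smul (g : QuotMfd Γ → ℝ) (s : Π m, D.Fib m) (x : HypSpace n) :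
    D.coords (g • s) x = g (quotProj Γ x) • D.coords s x := by
  simp [coords]

theorem fibLin_coords (s : Π m, D.Fib m) (x : HypSpace n) (m : QuotMfd Γ) (h : quotProj Γ x = m) :
    D.fibLin x m h (D.coords s x) = s m := by
  subst h; simp [coords]

variable [IsTorsionFreeDiscrete Γ]

open Classical in
/-- The local trivialisation of the bundle over a local section of `ℍⁿ → M`. -/
def pretriv (x : HypSpace n) : Pretrivialization V (π V D.Fib) where
  toFun p := ⟨p.1, if h : p.1 ∈ (localSec Γ x).source then
    (D.fibLin (localSec Γ x p.1) p.1 (quotProj_localSec Γ x h)).symm p.2 else 0⟩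
  invFun p := ⟨p.1, if h : p.1 ∈ (localSec Γ x).source then
    D.fibLin (localSec Γ x p.1) p.1 (quotProj_localSec Γ x h) p.2 else 0⟩
  source := π V D.Fib ⁻¹' (localSec Γ x).source
  target := (localSec Γ x).source ×ˢ univ
  baseSet := (localSec Γ x).source
  map_source' p hp := ⟨hp, trivial⟩
  map_target' p hp := hp.1
  left_inv' := by
    rintro ⟨m, f⟩ hp
    have hp' : m ∈ (localSec Γ x).source := hp
    simp [hp']
  right_inv' := by
    rintro ⟨m, v⟩ ⟨hp, -⟩
    have hp' : m ∈ (localSec Γ x).source := hp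
    simp [hp']
  open_target := (localSec Γ x).open_source.prod isOpen_univ
  open_baseSet := (localSec Γ x).open_source
  source_eq := rfl
  target_eq := rfl
  proj_toFun _ _ := rfl

theorem pretriv_apply (x : HypSpace n) (m : QuotMfd Γ) (h : m ∈ (localSec Γ x).source)
    (f : D.Fib m) : D.pretriv x ⟨m, f⟩ =
      (m, (D.fibLin (localSec Γ x m) m (quotProj_localSec Γ x h)).symm f) := by
  change (m, _) = _
  rw [dif_pos h]

theorem pretriv_symm (x : HypSpace n) (m : QuotMfd Γ) (h : m ∈ (localSec Γ x).source)
    (v : V) : (D.pretriv x).symm m v =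
      D.fibLin (localSec Γ x m) m (quotProj_localSec Γ x h) v := by
  have h1 := (D.pretriv x).apply_mk_symm (b := m) h v
  rw [D.pretriv_apply x m h] at h1
  exact (ContinuousLinearEquiv.symm_apply_eq _).1 (congrArg Prod.snd h1)

theorem exists_smooth_change (x y : HypSpace n) :
    ∃ f : QuotMfd Γ → V →L[ℝ] V,
      ContMDiffOn (𝓡 n) 𝓘(ℝ, V →L[ℝ] V) ∞ f ((localSec Γ x).source ∩ (localSec Γ y).source) ∧
      ∀ m ∈ (localSec Γ x).source ∩ (localSec Γ y).source, ∀ v : V,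
        f m v = (D.pretriv y ⟨m, (D.pretriv x).symm m v⟩).2 := by
  classical
  refine ⟨fun m => if hm : m ∈ (localSec Γ x).source ∩ (localSec Γ y).source then
    ((D.fibLin (localSec Γ x m) m (quotProj_localSec Γ x hm.1)).trans
      (D.fibLin (localSec Γ y m) m (quotProj_localSec Γ y hm.2)).symm : V →L[ℝ] V) else 0, ?_, ?_⟩
  · intro m hm
    refine ContMDiffAt.contMDiffWithinAt ?_
    obtain ⟨γ, hγ⟩ := localSec_change Γ x y hm.1 hm.2
    have h1 : ContMDiffAt (𝓡 n) (𝓡 n) ∞ (localSec Γ x) m :=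
      (localSec_contMDiffOn Γ x).contMDiffAt ((localSec Γ x).open_source.mem_nhds hm.1)
    have h2 : ContMDiffAt (𝓡 n) 𝓘(ℝ, V →L[ℝ] V) ∞ (fun m' => D.change γ (localSec Γ x m')) m :=
      (D.contMDiff_change γ).contMDiffAt.comp m h1
    refine h2.congr_of_eventuallyEq ?_
    filter_upwards [hγ, ((localSec Γ x).open_source.inter (localSec Γ y).open_source).mem_nhds hm]
      with m' h3 h4
    rw [dif_pos h4]
    ext v
    have h5 : ∀ (z : HypSpace n) (hz : quotProj Γ z = m'), z = γ • localSec Γ x m' →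
        D.fibLin z m' hz (D.change γ (localSec Γ x m') v) =
          D.fibLin (localSec Γ x m') m' (quotProj_localSec Γ x h4.1) v := by
      rintro z hz rfl
      exact D.fibLin_change _ _ _ _ _ _
    simp only [ContinuousLinearEquiv.coe_coe, ContinuousLinearEquiv.trans_apply]
    rw [ContinuousLinearEquiv.symm_apply_eq]
    exact (h5 _ (quotProj_localSec Γ y h4.2) h3).symm
  · intro m hm v
    refine (congrArg (fun L : V →L[ℝ] V => L v) (dif_pos hm)).trans ?_
    rw [D.pretriv_symm x m hm.1, D.pretriv_apply y m hm.2]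
    rfl

/-- The local trivialisations over all local sections of `ℍⁿ → M`. -/
def prebundle : VectorPrebundle ℝ V D.Fib where
  pretrivializationAtlas := Set.range D.pretriv
  pretrivialization_linear' := by
    rintro _ ⟨x, rfl⟩
    refine ⟨fun m hm => ?_⟩
    have hm' : m ∈ (localSec Γ x).source := hm
    simp only [D.pretriv_apply x m hm']
    exact (D.fibLin (localSec Γ x m) m _).symm.toLinearMap.isLinear
  pretrivializationAt m := D.pretriv (lift m)
  mem_base_pretrivializationAt m := by
    have := localSec_mem Γ (lift m)
    rwa [quotProj_lift] at this
  pretrivialization_mem_atlas m := ⟨_, rfl⟩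
  exists_coordChange := by
    rintro _ ⟨x, rfl⟩ _ ⟨y, rfl⟩
    obtain ⟨f, hf, hf'⟩ := D.exists_smooth_change x y
    exact ⟨f, hf.continuousOn, hf'⟩
  totalSpaceMk_isInducing m := by
    have hm : m ∈ (localSec Γ (lift m)).source := by
      have := localSec_mem Γ (lift m)
      rwa [quotProj_lift] at this
    have h : D.pretriv (lift m) ∘ TotalSpace.mk m = (fun v => (m, v)) ∘
        (D.fibLin (localSec Γ (lift m) m) m (quotProj_localSec Γ _ hm)).symm :=
      funext fun f => D.pretriv_apply _ m hm f
    rw [h]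
    exact (isInducing_const_prod.2 IsInducing.id).comp
      (D.fibLin _ m (quotProj_localSec Γ _ hm)).symm.toHomeomorph.isInducing

instance : TopologicalSpace (TotalSpace V D.Fib) := D.prebundle.totalSpaceTopology

instance : FiberBundle V D.Fib := D.prebundle.toFiberBundle

instance : VectorBundle ℝ V D.Fib := D.prebundle.toVectorBundle

instance : D.prebundle.IsContMDiff (𝓡 n) ∞ where
  exists_contMDiffCoordChange := by
    rintro _ ⟨x, rfl⟩ _ ⟨y, rfl⟩
    exact D.exists_smooth_change x y

instance : ContMDiffVectorBundle ∞ V D.Fib (𝓡 n) := D.prebundle.contMDiffVectorBundle (𝓡 n)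

theorem mdifferentiableAt_coords {s : Π m, D.Fib m} {x : HypSpace n}
    (hs : MDifferentiableAt (𝓡 n) ((𝓡 n).prod 𝓘(ℝ, V))
      (fun m => TotalSpace.mk' V m (s m)) (quotProj Γ x)) :
    MDifferentiableAt (𝓡 n) 𝓘(ℝ, V) (D.coords s) x := by
  have hx : quotProj Γ x ∈ (localSec Γ x).source := localSec_mem Γ x
  let e := D.prebundle.trivializationOfMemPretrivializationAtlas (e := D.pretriv x) ⟨x, rfl⟩
  have : MemTrivializationAtlas e := ⟨⟨_, ⟨x, rfl⟩, rfl⟩⟩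
  have h1 : MDifferentiableAt (𝓡 n) 𝓘(ℝ, V) (fun m => (e ⟨m, s m⟩).2) (quotProj Γ x) :=
    (Trivialization.mdifferentiableAt_section_iff (𝓡 n) e s hx).1 hs
  have h2 : MDifferentiableAt (𝓡 n) (𝓡 n) (quotProj Γ) x :=
    (quotProj_contMDiff Γ).mdifferentiableAt (by simp)
  refine (h1.comp x h2).congr_of_eventuallyEq ?_
  have hc : ContinuousAt (quotProj Γ) x := (quotProj_isLocalHomeomorph Γ).continuous.continuousAt
  filter_upwards [hc.eventually ((localSec Γ x).open_source.mem_nhds hx),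
    (localSec Γ x).open_target.mem_nhds
      ((quotProj_isLocalHomeomorph Γ).self_mem_localInverseAt_target (x := x))] with y h3 h4
  have h5 : localSec Γ x (quotProj Γ y) = y := by
    rw [← localSec_symm_apply Γ x, (localSec Γ x).right_inv h4]
  have h6 : ∀ (z : HypSpace n) (hz : quotProj Γ z = quotProj Γ y), z = y →
      (D.fibLin z (quotProj Γ y) hz).symm (s (quotProj Γ y)) = D.coords s y := by
    rintro z hz rfl; rfl
  change _ = (D.pretriv x ⟨quotProj Γ y, s (quotProj Γ y)⟩).2
  rw [D.pretriv_apply x _ h3]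
  exact (h6 _ _ h5).symm

theorem lift_mem (m : QuotMfd Γ) : m ∈ (localSec Γ (lift m)).source := by
  have := localSec_mem Γ (lift m)
  rwa [quotProj_lift] at this

/-- The coordinates of a section near `m`, in the frame along the local section of `ℍⁿ → M` through
the preferred lift of `m`. -/
def localCoords (s : Π m, D.Fib m) (m m' : QuotMfd Γ) : V :=
  D.coords s (localSec Γ (lift m) m')

theorem mdifferentiableAt_localCoords {s : Π m, D.Fib m} {m : QuotMfd Γ}
    (hs : MDifferentiableAt (𝓡 n) ((𝓡 n).prod 𝓘(ℝ, V)) (fun m => TotalSpace.mk' V m (s m)) m) :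
    MDifferentiableAt (𝓡 n) 𝓘(ℝ, V) (D.localCoords s m) m := by
  have h1 : MDifferentiableAt (𝓡 n) (𝓡 n) (localSec Γ (lift m)) m :=
    ((localSec_contMDiffOn Γ (lift m)).contMDiffAt
      ((localSec Γ (lift m)).open_source.mem_nhds (lift_mem m))).mdifferentiableAt (by simp)
  have h2 := D.mdifferentiableAt_coords (s := s) (x := localSec Γ (lift m) m) (by
    rw [quotProj_localSec Γ _ (lift_mem m)]; exact hs)
  exact h2.comp m h1

/-- The connection on the bundle with connection form `B` in the global frame over `ℍⁿ`: a section
with coordinate function `f` has covariant derivative with coordinates `X f + B(X) f` along any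
lift of the vector `X` (here: the lift by a local section of `ℍⁿ → M`). -/
def connFun (B : ∀ x : HypSpace n, TangentSpace (𝓡 n) x →L[ℝ] (V →L[ℝ] V))
    (s : Π m, D.Fib m) (m : QuotMfd Γ) : TangentSpace (𝓡 n) m →L[ℝ] D.Fib m :=
  (D.fibLin (localSec Γ (lift m) m) m (quotProj_localSec Γ _ (lift_mem m)) : V →L[ℝ] D.Fib m) ∘L
    (mvfderiv (𝓡 n) (D.localCoords s m) m +
      ContinuousLinearMap.apply ℝ V (D.localCoords s m m) ∘L B (localSec Γ (lift m) m) ∘L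
        mfderiv (𝓡 n) (𝓡 n) (localSec Γ (lift m)) m)

/-- The connection with connection form `B` in the global frame over `ℍⁿ`. -/
def conn (B : ∀ x : HypSpace n, TangentSpace (𝓡 n) x →L[ℝ] (V →L[ℝ] V)) :
    CovariantDerivative (𝓡 n) V D.Fib where
  toFun := D.connFun B
  isCovariantDerivativeOnUniv := by
    refine ⟨?_, ?_⟩
    · intro s t m hs ht _
      have h1 : D.localCoords (s + t) m = D.localCoords s m + D.localCoords t m := by
        funext m'; simp [localCoords, coords_add]
      simp only [connFun]
      rw [h1, mvfderiv_add (D.mdifferentiableAt_localCoords hs) (D.mdifferentiableAt_localCoords ht)]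
      ext X
      simp
      abel
    · intro s g m hs hg _
      have h1 : D.localCoords (g • s) m =ᶠ[𝓝 m] g • D.localCoords s m := by
        filter_upwards [(localSec Γ (lift m)).open_source.mem_nhds (lift_mem m)] with m' hm'
        simp [localCoords, coords_smul, quotProj_localSec Γ _ hm']
      have h2 : mvfderiv (𝓡 n) (D.localCoords (g • s) m) m =
          mvfderiv (𝓡 n) (g • D.localCoords s m) m := by
        exact ContinuousLinearMap.ext fun X => DFunLike.congr_fun h1.mfderiv_eq X
      have h3 := D.fibLin_coords s (localSec Γ (lift m) m) m (quotProj_localSec Γ _ (lift_mem m))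
      simp only [connFun]
      rw [h2, h1.self_of_nhds, mvfderiv_smul hg (D.mdifferentiableAt_localCoords hs)]
      ext X
      simp only [ContinuousLinearMap.comp_apply, add_apply,
        smul_apply, ContinuousLinearMap.smulRight_apply,
        ContinuousLinearMap.apply_apply, ContinuousLinearEquiv.coe_coe, map_add, map_smul,
        Pi.smul_apply', smul_add]
      have h4 : D.fibLin (localSec Γ (lift m) m) m (quotProj_localSec Γ _ (lift_mem m))
        (D.localCoords s m m) = s m := h3
      rw [h4]
      abel

end DescendedBundle

/-- Square matrices of size `n + 1` as a normed space (with the supremum norm). -/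
abbrev Mat (n : ℕ) : Type := Fin (n + 1) → Fin (n + 1) → ℝ

/-- The inclusion of `SL(n+1, ℝ)` in the space of matrices. -/
def SL.toMat {n : ℕ} (g : SL n) : Mat n := g.1

theorem SL.isInducing_toMat {n : ℕ} : Topology.IsInducing (SL.toMat (n := n)) :=
  Topology.IsInducing.subtypeVal

/-! ### Representations -/

/-- A (smooth) representation of the Lie group `SL(n+1, ℝ)` on `V`. Smoothness of a map on
`SL(n+1, ℝ)`, a closed submanifold of the space of matrices, means that it is locally the restriction
of a smooth map on matrices. -/
structure SmoothRep (n : ℕ) (V : Type u) [NormedAddCommGroup V] [NormedSpace ℝ V] extends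
    SL n →* (V →L[ℝ] V) where
  smooth : ∀ g : SL n, ∃ f : Mat n → (V →L[ℝ] V),
    ContDiffAt ℝ ∞ f g.toMat ∧ ∀ᶠ h : SL n in 𝓝 g, f h.toMat = toMonoidHom h

namespace SmoothRep

variable {n : ℕ} {V : Type u} [NormedAddCommGroup V] [NormedSpace ℝ V] (ρ : SmoothRep n V)

instance : CoeFun (SmoothRep n V) (fun _ => SL n → V →L[ℝ] V) := ⟨fun ρ => ρ.toMonoidHom⟩

theorem map_mul (g h : SL n) : ρ (g * h) = ρ g * ρ h := ρ.toMonoidHom.map_mul g h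

theorem map_one : ρ 1 = 1 := ρ.toMonoidHom.map_one

theorem map_mul_apply (g h : SL n) (v : V) : ρ (g * h) v = ρ g (ρ h v) := by
  rw [map_mul]; rfl

theorem inv_apply_self (g : SL n) (v : V) : ρ g⁻¹ (ρ g v) = v := by
  rw [← map_mul_apply, inv_mul_cancel, map_one]; rfl

theorem apply_inv_self (g : SL n) (v : V) : ρ g (ρ g⁻¹ v) = v := by
  rw [← map_mul_apply, mul_inv_cancel, map_one]; rfl

/-- The differential `𝔤 → 𝔤𝔩(V)` of the representation at the identity, computed with a smooth
extension of `ρ` to matrices near the identity. Only its values on `𝔤 = 𝔰𝔩(n+1, ℝ)`, the tangent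
space of `SL(n+1, ℝ)` at the identity, are used; they do not depend on the extension. -/
def differential : Mat n →L[ℝ] (V →L[ℝ] V) :=
  fderiv ℝ (ρ.smooth 1).choose (1 : SL n).toMat

/-- The differential is the derivative of `ρ` along curves in `SL(n+1, ℝ)` through the identity. -/
theorem hasDerivAt_differential (c : ℝ → SL n) (A : Mat n)
    (h0 : c 0 = 1) (hc : HasDerivAt (fun t => (c t).toMat) A 0) :
    HasDerivAt (fun t => ρ (c t)) (ρ.differential A) 0 := by
  obtain ⟨h1, h2⟩ := (ρ.smooth 1).choose_spec
  have h3 : HasFDerivAt (ρ.smooth 1).choose ρ.differential (c 0).toMat := by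
    rw [h0]; exact (h1.differentiableAt (by simp)).hasFDerivAt
  refine (h3.comp_hasDerivAt 0 hc).congr_of_eventuallyEq ?_
  have hcont : ContinuousAt c 0 :=
    SL.isInducing_toMat.continuousAt_iff.2 hc.continuousAt
  have h4 : ∀ᶠ h : SL n in 𝓝 (c 0), (ρ.smooth 1).choose h.toMat = ρ h := by rw [h0]; exact h2
  filter_upwards [hcont.eventually h4] with t ht
  exact ht.symm

theorem contMDiff_comp {f : HypSpace n → SL n}
    (hf : ContMDiff (𝓡 n) 𝓘(ℝ, Mat n) ∞ (fun x => (f x).toMat)) :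
    ContMDiff (𝓡 n) 𝓘(ℝ, V →L[ℝ] V) ∞ (fun x => ρ (f x)) := by
  intro x
  obtain ⟨F, h1, h2⟩ := ρ.smooth (f x)
  have hcont : ContinuousAt f x :=
    SL.isInducing_toMat.continuousAt_iff.2 hf.continuous.continuousAt
  refine (h1.contMDiffAt.comp x hf.contMDiffAt).congr_of_eventuallyEq ?_
  filter_upwards [hcont.eventually h2] with y hy
  exact hy.symm

end SmoothRep

/-! ### The canonical flat bundle -/

section Dev

variable {n : ℕ} (Γ : Subgroup (SOo n)) {V : Type u} [NormedAddCommGroup V] [NormedSpace ℝ V]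
  (μ : SO n →* (V →L[ℝ] V))

/-- The representation `dev` of `Γ` on `V`: the restriction of `μ` to `Γ ⊂ SO(n, 1)`. -/
def devRep : Γ →* (V →L[ℝ] V) :=
  μ.comp ((Subgroup.inclusion (SOo_le_SO n)).comp Γ.subtype)

/-- The equivalence relation `(x, v) ∼ (γ x, dev(γ) v)` on `ℍⁿ × V`. -/
def devSetoid : Setoid (HypSpace n × V) where
  r p q := ∃ γ : Γ, q = (γ • p.1, devRep Γ μ γ p.2)
  iseqv := by
    refine ⟨fun p => ⟨1, by simp⟩, ?_, ?_⟩
    · rintro p q ⟨γ, rfl⟩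
      refine ⟨γ⁻¹, ?_⟩
      have h : devRep Γ μ γ⁻¹ (devRep Γ μ γ p.2) = p.2 := by
        rw [← mul_apply_eq_comp, ← map_mul, inv_mul_cancel, map_one]; rfl
      simp [h]
    · rintro p q r ⟨γ, rfl⟩ ⟨δ, rfl⟩
      refine ⟨δ * γ, ?_⟩
      simp [mul_smul]

/-- The total space `F = ℍⁿ ×_dev V = Γ \ (ℍⁿ × V)` of the canonical flat bundle. -/
def DevTotal : Type u := Quotient (devSetoid Γ μ)

/-- The class of `(x, v)` in `ℍⁿ ×_dev V`. -/
def devMk (x : HypSpace n) (v : V) : DevTotal Γ μ := Quotient.mk (devSetoid Γ μ) (x, v)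

theorem devMk_eq_iff {x y : HypSpace n} {v w : V} :
    devMk Γ μ x v = devMk Γ μ y w ↔ ∃ γ : Γ, y = γ • x ∧ w = devRep Γ μ γ v := by
  refine (Quotient.eq (r := devSetoid Γ μ)).trans ?_
  exact exists_congr fun γ => Prod.ext_iff

/-- The bundle projection `F → M`. -/
def devProj : DevTotal Γ μ → QuotMfd Γ :=
  Quotient.lift (fun p => quotProj Γ p.1) (by
    rintro p q ⟨γ, rfl⟩
    exact (quotProj_smul Γ γ p.1).symm)

theorem devRep_apply_inv (γ : Γ) (v : V) : devRep Γ μ γ⁻¹ (devRep Γ μ γ v) = v := by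
  rw [← mul_apply_eq_comp, ← map_mul, inv_mul_cancel, map_one]; rfl

theorem devRep_inv_apply (γ : Γ) (v : V) : devRep Γ μ γ (devRep Γ μ γ⁻¹ v) = v := by
  rw [← mul_apply_eq_comp, ← map_mul, mul_inv_cancel, map_one]; rfl

variable [IsTorsionFreeDiscrete Γ]

/-- The canonical flat bundle `F = ℍⁿ ×_dev V` on `M`, with the frame `v ↦ [x, v]` over `ℍⁿ`. -/
def devBundle : DescendedBundle Γ V where
  Total := DevTotal Γ μ
  proj := devProj Γ μ
  frame := devMk Γ μ
  proj_frame _ _ := rfl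
  existsUnique_frame := by
    intro q x hq
    induction q using Quotient.inductionOn with | _ p => ?_
    obtain ⟨y, w⟩ := p
    obtain ⟨γ, rfl⟩ := (quotProj_eq_iff Γ).1 (show quotProj Γ x = quotProj Γ y from hq.symm)
    refine ⟨devRep Γ μ γ w, ?_, ?_⟩
    · exact ((devMk_eq_iff Γ μ).2 ⟨γ, rfl, rfl⟩).symm
    · intro v hv
      obtain ⟨δ, h1, rfl⟩ := (devMk_eq_iff Γ μ).1 (show devMk Γ μ _ _ = devMk Γ μ _ _ from hv)
      have : (δ * γ) • y = y := by rw [mul_smul]; exact h1.symm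
      have h2 : δ * γ = 1 := isCancelSMul_iff_eq_one_of_smul_eq.1 inferInstance _ _ this
      rw [eq_inv_of_mul_eq_one_right h2, devRep_apply_inv]
  change γ _ := devRep Γ μ γ
  frame_smul γ x v := ((devMk_eq_iff Γ μ).2 ⟨γ, rfl, rfl⟩).symm
  contMDiff_change _ := contMDiff_const

/-- The connection `∇^dev` on `F`, induced by the trivial connection on `ℍⁿ × V`: in the frame
`[x, ·]` it differentiates the coordinate function. -/
def devConnection : CovariantDerivative (𝓡 n) V (devBundle Γ μ).Fib :=
  (devBundle Γ μ).conn 0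

end Dev

/-! ### The Cartan bundle -/

section Cartan

variable {n : ℕ}

/-- The timelike basis vector `(0, …, 0, 1)`. -/
def timeVec (n : ℕ) : Fin (n + 1) → ℝ := Pi.single (Fin.last n) 1

/-- The parabolic subgroup `P ⊂ G`: the stabiliser of the ray through `(0, …, 0, 1)`. -/
def parabolic (n : ℕ) : Subgroup (SL n) where
  carrier := {A | ∃ t : ℝ, 0 < t ∧ A.1 *ᵥ timeVec n = t • timeVec n}
  one_mem' := ⟨1, one_pos, by simp⟩
  mul_mem' := by
    rintro A B ⟨s, hs, hA⟩ ⟨t, ht, hB⟩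
    refine ⟨t * s, mul_pos ht hs, ?_⟩
    rw [Matrix.SpecialLinearGroup.coe_mul, ← Matrix.mulVec_mulVec, hB, Matrix.mulVec_smul, hA,
      smul_smul]
  inv_mem' := by
    rintro A ⟨t, ht, hA⟩
    refine ⟨t⁻¹, inv_pos.2 ht, ?_⟩
    have h : (A⁻¹ : SL n).1 *ᵥ (A.1 *ᵥ timeVec n) = timeVec n := by
      rw [Matrix.mulVec_mulVec, ← Matrix.SpecialLinearGroup.coe_mul, inv_mul_cancel]; simp
    rw [hA, Matrix.mulVec_smul] at h
    rw [← h, smul_smul, inv_mul_cancel₀ ht.ne', one_smul, h]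

/-- The cone of vectors on the rays through the hyperboloid sheet. -/
def futureCone (n : ℕ) : Set (Fin (n + 1) → ℝ) := {v | ∃ t : ℝ, 0 < t ∧ t • v ∈ sheet n}

/-- The point of `ℍⁿ` on the ray through `v`. -/
def rayPoint (v : Fin (n + 1) → ℝ) (hv : v ∈ futureCone n) : HypSpace n :=
  ⟨hv.choose • v, hv.choose_spec.2⟩

theorem lorentz_smul_smul (s : ℝ) (v : Fin (n + 1) → ℝ) :
    lorentz (s • v) (s • v) = s ^ 2 * lorentz v v := by
  simp only [lorentz, Pi.smul_apply, smul_eq_mul, mul_sub, Finset.mul_sum]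
  congr 1
  · exact Finset.sum_congr rfl fun i _ => by ring
  · ring

theorem rayPoint_unique {v : Fin (n + 1) → ℝ} (hv : v ∈ futureCone n) {t : ℝ} (ht : 0 < t)
    {x : HypSpace n} (hx : x.1 = t • v) : rayPoint v hv = x := by
  apply HypSpace.ext
  rw [hx]
  change hv.choose • v = t • v
  have h1 := hv.choose_spec.2.1
  have h0 := hv.choose_spec.1
  have h2 := x.2.1
  rw [hx] at h2
  rw [lorentz_smul_smul] at h1 h2
  have h3 : hv.choose ^ 2 = t ^ 2 := by
    have h4 : lorentz v v ≠ 0 := by rintro h; rw [h] at h2; norm_num at h2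
    exact mul_right_cancel₀ h4 (h1.trans h2.symm)
  rw [(pow_left_inj₀ h0.le ht.le two_ne_zero).1 h3]

/-- The part of `G = SL(n+1, ℝ)` lying over `ℍⁿ ⊂ 𝕊ⁿ = G / P`: here `𝕊ⁿ` is the space of rays of
`ℝⁿ⁺¹`, `G → G / P` sends `g` to the ray through `g (0, …, 0, 1)`, and `ℍⁿ` is identified with the
set of rays through points of the hyperboloid sheet. -/
def GOver (n : ℕ) : Type := {g : SL n // g.1 *ᵥ timeVec n ∈ futureCone n}

/-- The projection `G ⊃ GOver → ℍⁿ ⊂ G / P`. -/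
def GOver.toHyp (g : GOver n) : HypSpace n := rayPoint _ g.2

theorem futureCone_smul (A : SOo n) {v : Fin (n + 1) → ℝ} (hv : v ∈ futureCone n) :
    A.1.1 *ᵥ v ∈ futureCone n := by
  obtain ⟨t, ht, h⟩ := hv
  refine ⟨t, ht, ?_⟩
  rw [← Matrix.mulVec_smul]
  exact (A.2.2 _).2 h

/-- Left multiplication by isometries. -/
def GOver.leftMul (A : SOo n) (g : GOver n) : GOver n :=
  ⟨A.1 * g.1, by
    rw [Matrix.SpecialLinearGroup.coe_mul, ← Matrix.mulVec_mulVec]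
    exact futureCone_smul A g.2⟩

/-- The right principal action of `P`. -/
def GOver.rightMul (g : GOver n) (p : parabolic n) : GOver n :=
  ⟨g.1 * p.1, by
    obtain ⟨s, hs, h⟩ := p.2
    obtain ⟨t, ht, h'⟩ := g.2
    refine ⟨t * s⁻¹, by positivity, ?_⟩
    rw [Matrix.SpecialLinearGroup.coe_mul, ← Matrix.mulVec_mulVec, h, Matrix.mulVec_smul,
      smul_smul, mul_assoc, inv_mul_cancel₀ hs.ne', mul_one]
    exact h'⟩

theorem GOver.toHyp_leftMul (A : SOo n) (g : GOver n) : (g.leftMul A).toHyp = A • g.toHyp := by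
  refine rayPoint_unique _ g.2.choose_spec.1 ?_
  rw [SOo.coe_smul]
  change A.1.1 *ᵥ (_ • _) = _ • ((A.1 * g.1).1 *ᵥ _)
  rw [Matrix.mulVec_smul, Matrix.SpecialLinearGroup.coe_mul, Matrix.mulVec_mulVec]

/-- The fibres of `GOver → ℍⁿ` are the cosets of `P`. -/
theorem GOver.toHyp_eq_iff (g h : GOver n) :
    g.toHyp = h.toHyp ↔ ∃ p : parabolic n, h = g.rightMul p := by
  constructor
  · intro hgh
    have h1 : g.2.choose • (g.1.1 *ᵥ timeVec n) = h.2.choose • (h.1.1 *ᵥ timeVec n) :=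
      congrArg Subtype.val hgh
    have hg := g.2.choose_spec.1
    have hh := h.2.choose_spec.1
    generalize g.2.choose = s at h1 hg
    generalize h.2.choose = t at h1 hh
    refine ⟨⟨g.1⁻¹ * h.1, t⁻¹ * s, by positivity, ?_⟩, ?_⟩
    · have h2 : h.1.1 *ᵥ timeVec n = (t⁻¹ * s) • (g.1.1 *ᵥ timeVec n) := by
        rw [mul_smul, h1, smul_smul, inv_mul_cancel₀ hh.ne', one_smul]
      rw [Matrix.SpecialLinearGroup.coe_mul, ← Matrix.mulVec_mulVec, h2, Matrix.mulVec_smul]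
      congr 1
      rw [Matrix.mulVec_mulVec, ← Matrix.SpecialLinearGroup.coe_mul, inv_mul_cancel]; simp
    · apply Subtype.ext
      change h.1 = g.1 * (g.1⁻¹ * h.1)
      group
  · rintro ⟨p, rfl⟩
    obtain ⟨s, hs, h⟩ := p.2
    refine rayPoint_unique _ (t := (g.rightMul p).2.choose * s)
      (mul_pos (g.rightMul p).2.choose_spec.1 hs) ?_
    change _ • ((g.1 * p.1).1 *ᵥ timeVec n) = _
    rw [Matrix.SpecialLinearGroup.coe_mul, ← Matrix.mulVec_mulVec, h, Matrix.mulVec_smul, smul_smul]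

variable (Γ : Subgroup (SOo n))

/-- The left action of `Γ` on the part of `G` over `ℍⁿ`. -/
def cartanSetoid : Setoid (GOver n) where
  r g h := ∃ γ : Γ, h = g.leftMul γ.1
  iseqv := by
    refine ⟨fun g => ⟨1, Subtype.ext (one_mul g.1).symm⟩, ?_, ?_⟩
    · rintro g h ⟨γ, rfl⟩
      refine ⟨γ⁻¹, Subtype.ext ?_⟩
      exact (inv_mul_cancel_left γ.1.1 g.1).symm
    · rintro g h k ⟨γ, rfl⟩ ⟨δ, rfl⟩
      exact ⟨δ * γ, Subtype.ext (mul_assoc δ.1.1 γ.1.1 g.1).symm⟩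

/-- The Cartan bundle `𝒢_Γ = Γ \ G`, restricted to the part of `G` over `ℍⁿ`; it is a principal
`P`-bundle over `M`. -/
def CartanBundle : Type := Quotient (cartanSetoid Γ)

/-- The class `[g] ∈ 𝒢_Γ` of `g ∈ G`. -/
def cartanMk (g : GOver n) : CartanBundle Γ := Quotient.mk (cartanSetoid Γ) g

theorem cartanMk_eq_iff {g h : GOver n} :
    cartanMk Γ g = cartanMk Γ h ↔ ∃ γ : Γ, h = g.leftMul γ.1 := by
  exact Quotient.eq (r := cartanSetoid Γ)

/-- The bundle projection `𝒢_Γ → M`. -/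
def cartanProj : CartanBundle Γ → QuotMfd Γ :=
  Quotient.lift (fun g => quotProj Γ g.toHyp) (by
    rintro g h ⟨γ, rfl⟩
    rw [GOver.toHyp_leftMul]
    exact (quotProj_smul Γ γ _).symm)

/-- The right principal action of `P` on `𝒢_Γ`. -/
def cartanRightMul (u : CartanBundle Γ) (p : parabolic n) : CartanBundle Γ :=
  Quotient.map (fun g => g.rightMul p) (by
    rintro g h ⟨γ, rfl⟩
    exact ⟨γ, Subtype.ext (mul_assoc γ.1.1 g.1 p.1)⟩) u

theorem cartanProj_rightMul (u : CartanBundle Γ) (p : parabolic n) :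
    cartanProj Γ (cartanRightMul Γ u p) = cartanProj Γ u := by
  induction u using Quotient.inductionOn with | _ g => ?_
  exact congrArg (quotProj Γ) ((GOver.toHyp_eq_iff g _).2 ⟨p, rfl⟩).symm

/-- The Maurer-Cartan form of `G`, `ω(ξ) = g⁻¹ ξ` for a tangent vector `ξ` (a matrix) of
`G = SL(n+1, ℝ)` at `g`. Being left-invariant, it is also the Cartan connection of `𝒢_Γ`. -/
def maurerCartan (g : SL n) : Mat n →L[ℝ] Mat n :=
  LinearMap.toContinuousLinearMap
    { toFun := fun ξ => Matrix.of.symm ((g⁻¹ : SL n).1 * Matrix.of ξ)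
      map_add' := fun ξ _ => congrArg Matrix.of.symm (mul_add (g⁻¹ : SL n).1 (Matrix.of ξ) _)
      map_smul' := fun a ξ => congrArg Matrix.of.symm
        (mul_smul_comm a (g⁻¹ : SL n).1 (Matrix.of ξ)) }

/-! ### Tractor bundles -/

variable {V : Type u} [NormedAddCommGroup V] [NormedSpace ℝ V] (ρ : SmoothRep n V)

theorem cartanRightMul_one (u : CartanBundle Γ) : cartanRightMul Γ u 1 = u := by
  induction u using Quotient.inductionOn with | _ g => ?_
  exact congrArg (cartanMk Γ) (Subtype.ext (mul_one g.1))

theorem cartanRightMul_mul (u : CartanBundle Γ) (p q : parabolic n) :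
    cartanRightMul Γ u (p * q) = cartanRightMul Γ (cartanRightMul Γ u p) q := by
  induction u using Quotient.inductionOn with | _ g => ?_
  exact congrArg (cartanMk Γ) (Subtype.ext (mul_assoc g.1 p.1 q.1).symm)

/-- The equivalence relation `(u, v) ∼ (u p, ρ(p)⁻¹ v)` on `𝒢_Γ × V`, for `p ∈ P`. -/
def tractorSetoid : Setoid (CartanBundle Γ × V) where
  r a b := ∃ p : parabolic n, b = (cartanRightMul Γ a.1 p, ρ (p.1⁻¹) a.2)
  iseqv := by
    refine ⟨fun a => ⟨1, ?_⟩, ?_, ?_⟩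
    · rw [cartanRightMul_one]
      simp [ρ.map_one]
    · rintro a b ⟨p, rfl⟩
      refine ⟨p⁻¹, ?_⟩
      simp [← cartanRightMul_mul, cartanRightMul_one, ρ.apply_inv_self]
    · rintro a b c ⟨p, rfl⟩ ⟨q, rfl⟩
      refine ⟨p * q, ?_⟩
      simp [cartanRightMul_mul]

/-- The total space `𝒯 = 𝒢_Γ ×_ρ V` of the tractor bundle. -/
def TractorTotal : Type u := Quotient (tractorSetoid Γ ρ)

/-- The class of `(u, v)` in `𝒢_Γ ×_ρ V`. -/
def tractorMk (u : CartanBundle Γ) (v : V) : TractorTotal Γ ρ :=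
  Quotient.mk (tractorSetoid Γ ρ) (u, v)

theorem tractorMk_eq_iff {u w : CartanBundle Γ} {v v' : V} :
    tractorMk Γ ρ u v = tractorMk Γ ρ w v' ↔
      ∃ p : parabolic n, w = cartanRightMul Γ u p ∧ v' = ρ (p.1⁻¹) v := by
  refine (Quotient.eq (r := tractorSetoid Γ ρ)).trans ?_
  exact exists_congr fun γ => Prod.ext_iff

/-- The bundle projection `𝒯 → M`. -/
def tractorProj : TractorTotal Γ ρ → QuotMfd Γ :=
  Quotient.lift (fun a => cartanProj Γ a.1) (by
    rintro a b ⟨p, rfl⟩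
    exact (cartanProj_rightMul Γ a.1 p).symm)

/-- The matrix with the identity in the upper left corner and last column the vector `x / xₙ₊₁`. -/
def hypSectionMatrix (x : HypSpace n) : Matrix (Fin (n + 1)) (Fin (n + 1)) ℝ :=
  (1 : Matrix _ _ ℝ).updateCol (Fin.last n) ((x.1 (Fin.last n))⁻¹ • x.1)

theorem hypSectionMatrix_det (x : HypSpace n) : (hypSectionMatrix x).det = 1 := by
  rw [hypSectionMatrix, Matrix.det_of_isUpperTriangular]
  · rw [Fin.prod_univ_castSucc]
    have h : x.1 (Fin.last n) ≠ 0 := x.2.2.ne'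
    simp [h]
  · intro i j hij
    have h1 : j ≠ Fin.last n := (lt_of_lt_of_le hij (Fin.le_last i)).ne
    rw [Matrix.updateCol_ne h1]
    exact Matrix.one_apply_ne (ne_of_gt hij)

theorem hypSectionMatrix_mulVec (x : HypSpace n) :
    hypSectionMatrix x *ᵥ timeVec n = (x.1 (Fin.last n))⁻¹ • x.1 := by
  rw [timeVec, Matrix.mulVec_single_one]
  ext i
  simp [hypSectionMatrix, Matrix.col_apply]

theorem smul_hypSectionMatrix_mulVec (x : HypSpace n) :
    x.1 (Fin.last n) • (hypSectionMatrix x *ᵥ timeVec n) = x.1 := by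
  rw [hypSectionMatrix_mulVec, smul_smul, mul_inv_cancel₀ x.2.2.ne', one_smul]

/-- A smooth section of `G → G / P` over `ℍⁿ`. -/
def hypSection (x : HypSpace n) : GOver n :=
  ⟨⟨hypSectionMatrix x, hypSectionMatrix_det x⟩, by
    refine ⟨x.1 (Fin.last n), x.2.2, ?_⟩
    rw [smul_hypSectionMatrix_mulVec]
    exact x.2⟩

theorem toHyp_hypSection (x : HypSpace n) : (hypSection x).toHyp = x :=
  rayPoint_unique _ x.2.2 (smul_hypSectionMatrix_mulVec x).symm

theorem contMDiff_hypSection : ContMDiff (𝓡 n) 𝓘(ℝ, Mat n) ∞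
    (fun x : HypSpace n => (hypSection x).1.toMat) := by
  have hx : ∀ i, ContMDiff (𝓡 n) 𝓘(ℝ, ℝ) ∞ (fun x : HypSpace n => x.1 i) := fun i =>
    (contMDiff_pi_space.1 (HypSpace.contMDiff_val n)) i
  refine contMDiff_pi_space.2 fun i => contMDiff_pi_space.2 fun j => ?_
  by_cases h : j = Fin.last n
  · subst h
    have h2 : ∀ x : HypSpace n, (hypSection x).1.toMat i (Fin.last n) =
        (x.1 (Fin.last n))⁻¹ * x.1 i := fun x => by
      change hypSectionMatrix x i (Fin.last n) = _
      simp [hypSectionMatrix]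
    simp only [h2]
    exact ((hx _).inv₀ fun x => x.2.2.ne').mul (hx i)
  · have h2 : ∀ x : HypSpace n, (hypSection x).1.toMat i j =
        (1 : Matrix (Fin (n + 1)) (Fin (n + 1)) ℝ) i j := fun x => by
      change hypSectionMatrix x i j = _
      rw [hypSectionMatrix, Matrix.updateCol_ne h]
    simp only [h2]
    exact contMDiff_const

end Cartan

section Tractor

variable {n : ℕ}

theorem SL.contMDiff_inv {f : HypSpace n → SL n}
    (hf : ContMDiff (𝓡 n) 𝓘(ℝ, Mat n) ∞ (fun x => (f x).toMat)) :
    ContMDiff (𝓡 n) 𝓘(ℝ, Mat n) ∞ (fun x => ((f x)⁻¹ : SL n).toMat) := by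
  have h : ContDiff ℝ ∞ (fun A : Mat n => Matrix.of.symm (Matrix.adjugate (Matrix.of A))) := by
    refine contDiff_pi.2 fun i => contDiff_pi.2 fun j => ?_
    simp only [Matrix.of_symm_apply, Matrix.adjugate_apply, Matrix.det_apply]
    refine ContDiff.sum fun σ _ => ContDiff.const_smul _ (contDiff_prod fun k _ => ?_)
    by_cases hk : σ k = j
    · simp only [Matrix.updateRow_apply, hk, if_true]
      exact contDiff_const
    · simp only [Matrix.updateRow_apply, hk, if_false]
      exact contDiff_apply_apply ℝ ℝ (σ k) k
  refine (h.contMDiff.comp hf).congr fun x => ?_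
  exact congrArg (fun A : Matrix _ _ ℝ => (A : Mat n)) (Matrix.SpecialLinearGroup.coe_inv (f x))

variable (Γ : Subgroup (SOo n)) {V : Type u} [NormedAddCommGroup V] [NormedSpace ℝ V]
  (ρ : SmoothRep n V)

/-- Two points of `G` over points of `ℍⁿ` in the same orbit give the same elements of the fibre, up
to the action of the group. -/
theorem tractorMk_eq_of_smul (g h : GOver n) (γ : Γ) (hgh : h.toHyp = γ • g.toHyp) (v : V) :
    tractorMk Γ ρ (cartanMk Γ g) v =
      tractorMk Γ ρ (cartanMk Γ h) (ρ (h.1⁻¹ * (γ.1.1 * g.1)) v) := by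
  have h1 : (g.leftMul γ.1).toHyp = h.toHyp := by
    rw [GOver.toHyp_leftMul, hgh]; rfl
  obtain ⟨p, hp⟩ := (GOver.toHyp_eq_iff _ _).1 h1
  have h2 : cartanMk Γ g = cartanMk Γ (g.leftMul γ.1) := (cartanMk_eq_iff Γ).2 ⟨γ, rfl⟩
  rw [h2]
  refine (tractorMk_eq_iff Γ ρ).2 ⟨p, congrArg (cartanMk Γ) hp, ?_⟩
  have h3 : h.1 = γ.1.1 * g.1 * p.1 := congrArg Subtype.val hp
  rw [h3]
  congr 2
  group

theorem tractorMk_injective [IsTorsionFreeDiscrete Γ] (g : GOver n) {v w : V}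
    (h : tractorMk Γ ρ (cartanMk Γ g) v = tractorMk Γ ρ (cartanMk Γ g) w) : v = w := by
  obtain ⟨p, h1, rfl⟩ := (tractorMk_eq_iff Γ ρ).1 h
  obtain ⟨γ, h2⟩ := (cartanMk_eq_iff Γ).1 (show cartanMk Γ g = cartanMk Γ (g.rightMul p) from h1)
  have h3 : g.toHyp = γ • g.toHyp :=
    ((GOver.toHyp_eq_iff g _).2 ⟨p, rfl⟩).trans
      ((congrArg GOver.toHyp h2).trans (GOver.toHyp_leftMul γ.1 g))
  have h4 : γ = 1 := isCancelSMul_iff_eq_one_of_smul_eq.1 inferInstance _ _ h3.symm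
  subst h4
  have h5 : g.1 * p.1 = 1 * g.1 := congrArg Subtype.val h2
  have h6 : p.1 = 1 := by simpa using h5
  rw [h6, inv_one, ρ.map_one]; rfl

variable [IsTorsionFreeDiscrete Γ]

/-- The tractor bundle `𝒯 = 𝒢_Γ ×_ρ V` on `M`. The smooth structure is the one for which
`(x, v) ↦ [[τ(x)], v]` is a smooth frame over `ℍⁿ`, `τ` being a smooth section of `G → G / P`. -/
def tractorBundle : DescendedBundle Γ V where
  Total := TractorTotal Γ ρ
  proj := tractorProj Γ ρ
  frame x v := tractorMk Γ ρ (cartanMk Γ (hypSection x)) v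
  proj_frame x _ := congrArg (quotProj Γ) (toHyp_hypSection x)
  existsUnique_frame := by
    intro q x hq
    induction q using Quotient.inductionOn with | _ a => ?_
    obtain ⟨u, w⟩ := a
    induction u using Quotient.inductionOn with | _ g => ?_
    obtain ⟨γ, hγ⟩ := (quotProj_eq_iff Γ).1
      (show quotProj Γ x = quotProj Γ g.toHyp from hq.symm)
    have h := tractorMk_eq_of_smul Γ ρ g (hypSection x) γ ((toHyp_hypSection x).trans hγ.symm) w
    refine ⟨_, h.symm, fun v hv => ?_⟩
    exact tractorMk_injective Γ ρ (hypSection x) (hv.trans h)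
  change γ x := ρ ((hypSection (γ • x)).1⁻¹ * (γ.1.1 * (hypSection x).1))
  frame_smul γ x v := by
    refine (tractorMk_eq_of_smul Γ ρ (hypSection x) (hypSection (γ • x)) γ ?_ v).symm
    rw [toHyp_hypSection, toHyp_hypSection]
  contMDiff_change γ := by
    have h1 : ContMDiff (𝓡 n) 𝓘(ℝ, V →L[ℝ] V) ∞ (fun x : HypSpace n => ρ (hypSection x).1) :=
      ρ.contMDiff_comp contMDiff_hypSection
    have h2 : ContMDiff (𝓡 n) 𝓘(ℝ, V →L[ℝ] V) ∞
        (fun x : HypSpace n => ρ ((hypSection (γ • x)).1⁻¹)) :=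
      (ρ.contMDiff_comp (SL.contMDiff_inv contMDiff_hypSection)).comp (SOo.contMDiff_smul γ.1)
    simp only [ρ.map_mul]
    exact h2.clm_comp (contMDiff_const.clm_comp h1)

/-- The tractor connection on `𝒢_Γ ×_ρ V`, induced by the Cartan connection `ω` of `𝒢_Γ`: along the
section `τ` of `G → G / P` the connection form is `X ↦ dρ(ω(dτ(X)))`. -/
def tractorConnection : CovariantDerivative (𝓡 n) V (tractorBundle Γ ρ).Fib :=
  (tractorBundle Γ ρ).conn fun x => ρ.differential ∘L maurerCartan (hypSection x).1 ∘L
    mvfderiv (𝓡 n) (fun y : HypSpace n => (hypSection y).1.toMat) x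

end Tractor

/-! ### The geometric meaning of the two connections, and flatness -/

section Main

variable {n : ℕ} (Γ : Subgroup (SOo n)) [IsTorsionFreeDiscrete Γ]
  {V : Type u} [NormedAddCommGroup V] [NormedSpace ℝ V]

/-- The class `[x, v]` as an element of the fibre of `ℍⁿ ×_dev V`. -/
def devClass (μ : SO n →* (V →L[ℝ] V)) (x : HypSpace n) (v : V) :
    (devBundle Γ μ).Fib (quotProj Γ x) := ⟨devMk Γ μ x v, rfl⟩

/-- The class `[u, v]` as an element of the fibre of `𝒢_Γ ×_ρ V`. -/
def tractorClass (ρ : SmoothRep n V) (u : CartanBundle Γ) (v : V) :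
    (tractorBundle Γ ρ).Fib (cartanProj Γ u) := ⟨tractorMk Γ ρ u v, rfl⟩

/-- The section `s` is differentiable at `m`. -/
def DiffAt {D : DescendedBundle Γ V} (s : Π m, D.Fib m) (m : QuotMfd Γ) : Prop :=
  MDifferentiableAt (𝓡 n) ((𝓡 n).prod 𝓘(ℝ, V)) (fun m => TotalSpace.mk' V m (s m)) m

/-- `∇` is induced by the trivial connection on `ℍⁿ × V`: if the section `s` of `ℍⁿ ×_dev V` is
`s(π x) = [x, f x]`, then `∇_X s = [x, df(X')]` for `X` the projection of a tangent vector `X'` of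
`ℍⁿ` at `x`. -/
def IsDevConnection (μ : SO n →* (V →L[ℝ] V))
    (D : CovariantDerivative (𝓡 n) V (devBundle Γ μ).Fib) : Prop :=
  ∀ (s : Π m, (devBundle Γ μ).Fib m) (f : HypSpace n → V),
    (∀ y, s (quotProj Γ y) = devClass Γ μ y (f y)) →
    ∀ (x : HypSpace n), DiffAt Γ s (quotProj Γ x) →
      MDifferentiableAt (𝓡 n) 𝓘(ℝ, V) f x ∧
      ∀ X : TangentSpace (𝓡 n) x,
        D s (quotProj Γ x) (mfderiv (𝓡 n) (𝓡 n) (quotProj Γ) x X) =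
          devClass Γ μ x (mvfderiv (𝓡 n) f x X)

/-- `∇` is the tractor connection: if the section `s` of `𝒢_Γ ×_ρ V` corresponds to the equivariant
function `σ : 𝒢_Γ → V`, that is, `s(π u) = [u, σ u]`, then `∇_X s = [u, dσ(X') + dρ(ω(X')) σ(u)]`
for every tangent vector `X'` of `𝒢_Γ` at `u` that projects to `X`. Tangent vectors of `𝒢_Γ` are
given by the derivatives `ξ` of curves `c` in `G`. -/
def IsTractorConnection (ρ : SmoothRep n V)
    (D : CovariantDerivative (𝓡 n) V (tractorBundle Γ ρ).Fib) : Prop :=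
  ∀ (s : Π m, (tractorBundle Γ ρ).Fib m) (σ : CartanBundle Γ → V),
    (∀ u, s (cartanProj Γ u) = tractorClass Γ ρ u (σ u)) →
    ∀ (c : ℝ → GOver n) (ξ : Mat n), HasDerivAt (fun t => (c t).1.toMat) ξ 0 →
      DiffAt Γ s (cartanProj Γ (cartanMk Γ (c 0))) →
      MDifferentiableAt 𝓘(ℝ, ℝ) (𝓡 n) (fun t => cartanProj Γ (cartanMk Γ (c t))) 0 ∧
      ∃ v : V, HasDerivAt (fun t => σ (cartanMk Γ (c t))) v 0 ∧
        D s (cartanProj Γ (cartanMk Γ (c 0)))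
            (mfderiv 𝓘(ℝ, ℝ) (𝓡 n) (fun t => cartanProj Γ (cartanMk Γ (c t))) 0 (1 : ℝ)) =
          tractorClass Γ ρ (cartanMk Γ (c 0))
            (v + ρ.differential (maurerCartan (c 0).1 ξ) (σ (cartanMk Γ (c 0))))

variable {Γ}

/-- The connection is flat: its curvature `∇_X ∇_Y s - ∇_Y ∇_X s - ∇_[X, Y] s` vanishes. -/
def IsFlat {B : DescendedBundle Γ V} (D : CovariantDerivative (𝓡 n) V B.Fib) : Prop :=
  ∀ (X Y : Π m : QuotMfd Γ, TangentSpace (𝓡 n) m) (s : Π m, B.Fib m),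
    ContMDiff (𝓡 n) (𝓡 n).tangent ∞ (fun m => TotalSpace.mk' (EuclideanSpace ℝ (Fin n)) m (X m)) →
    ContMDiff (𝓡 n) (𝓡 n).tangent ∞ (fun m => TotalSpace.mk' (EuclideanSpace ℝ (Fin n)) m (Y m)) →
    ContMDiff (𝓡 n) ((𝓡 n).prod 𝓘(ℝ, V)) ∞ (fun m => TotalSpace.mk' V m (s m)) →
    ∀ m, D (fun m' => D s m' (Y m')) m (X m) - D (fun m' => D s m' (X m')) m (Y m) -
      D s m (VectorField.mlieBracket (𝓡 n) X Y m) = 0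

end Main

end HypTractor

end

open HypTractor

/-! Pulled back to `ℍⁿ`, either bundle is trivialised by its frame, and a section becomes a function
`f : ℍⁿ → V` that the transition maps of the frame make equivariant. The proof rests on a change of
frame, called a flat gauge (`IsFlatGauge`): a smooth invertible operator-valued function `T` on `ℍⁿ`
after which the transition maps are constant operators `C γ`. If the connection form of a bundle is
`T⁻¹ dT`, then by the product rule `T (df + T⁻¹ dT f) = d(T f)`. In the coordinates `T f` the
connection is therefore the plain derivative (`IsFlatGauge.conn_apply`), and these coordinates
satisfy `F (γ x) = C γ (F x)`.

The bundle `F` has the gauge `T = 1`, with `C γ = μ γ` and connection form `0`. For the tractor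
bundle let `τ` be the section `hypSection` of `G → G / P` over `ℍⁿ`. The transition maps are
`ρ(τ(γx)⁻¹ γ τ(x))`, so `T = ρ ∘ τ` is a gauge with `C γ = ρ γ`. Moreover `T⁻¹ dT = dρ(τ⁻¹ dτ) =
dρ(ω(dτ))`, which is the tractor connection form (`tractorConnection_form`). Both flat bundles are
thus the trivial connection on equivariant functions, for the representations `μ` and `ρ` of `Γ`,
and the constant map `θ` intertwines these. Hence `θ` in flat coordinates is a parallel isomorphism
(`IsFlatGauge.iso`, `IsFlatGauge.iso_conn`).

Flatness is the symmetry of second derivatives (`IsFlatGauge.isFlat_conn`). The formula for `Φ`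
holds for every `g` over `x` because `[[g], ρ(g)⁻¹ w]` depends on `g` only through `gP`
(`tractorMk_inv_apply`). The description of the tractor connection by curves in `G` comes from
differentiating `σ(g) = ρ(g)⁻¹ F(gP)`: the derivative of `ρ(g)⁻¹` contributes `-dρ(ω) σ`, which the
Cartan term cancels. -/

noncomputable section

namespace HypTractor

universe u

/-! ### Differentiation of vector-valued maps on manifolds -/

section Derivatives

variable {E : Type*} [NormedAddCommGroup E] [NormedSpace ℝ E]
  {H : Type*} [TopologicalSpace H] {I : ModelWithCorners ℝ E H}
  {M : Type*} [TopologicalSpace M] [ChartedSpace H M]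
  {E' : Type*} [NormedAddCommGroup E'] [NormedSpace ℝ E']
  {H' : Type*} [TopologicalSpace H'] {I' : ModelWithCorners ℝ E' H'}
  {M' : Type*} [TopologicalSpace M'] [ChartedSpace H' M']
  {F F' : Type*} [NormedAddCommGroup F] [NormedSpace ℝ F]
  [NormedAddCommGroup F'] [NormedSpace ℝ F']

theorem mvfderiv_clm_apply {g : M → F →L[ℝ] F'} {f : M → F} {x : M}
    (hg : MDifferentiableAt I 𝓘(ℝ, F →L[ℝ] F') g x) (hf : MDifferentiableAt I 𝓘(ℝ, F) f x)
    (X : TangentSpace I x) :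
    mvfderiv I (fun y => g y (f y)) x X =
      mvfderiv I g x X (f x) + g x (mvfderiv I f x X) := by
  have h0 : IsBoundedBilinearMap ℝ (fun p : (F →L[ℝ] F') × F => p.1 p.2) :=
    isBoundedBilinearMap_apply
  have h1 := (h0.hasFDerivAt (g x, f x)).hasMFDerivAt
  -- The pair is a map into a single normed space, with its own model rather than the product of two
  -- models, so that it composes with the derivative of the evaluation pairing.
  have h2 : HasMFDerivAt I 𝓘(ℝ, (F →L[ℝ] F') × F) (fun y => (g y, f y)) x
      ((mvfderiv I g x).prod (mvfderiv I f x)) :=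
    ⟨hg.hasMFDerivAt.1.prodMk hf.hasMFDerivAt.1, hg.hasMFDerivAt.2.prodMk hf.hasMFDerivAt.2⟩
  have h3 := (h1.comp x h2).mfderiv
  refine (DFunLike.congr_fun h3 X).trans ?_
  exact add_comm _ _

theorem mvfderiv_comp_clm (L : F →L[ℝ] F') {f : M → F} {x : M}
    (hf : MDifferentiableAt I 𝓘(ℝ, F) f x) (X : TangentSpace I x) :
    mvfderiv I (fun y => L (f y)) x X = L (mvfderiv I f x X) := by
  have h1 : HasMFDerivAt 𝓘(ℝ, F) 𝓘(ℝ, F') L (f x) L := L.hasMFDerivAt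
  exact DFunLike.congr_fun (h1.comp x hf.hasMFDerivAt).mfderiv X

theorem mvfderiv_comp_map {g : M → F} {f : M' → M} {y : M} (x : M') (hy : f x = y)
    (hg : MDifferentiableAt I 𝓘(ℝ, F) g y) (hf : MDifferentiableAt I' I f x)
    (X : TangentSpace I' x) :
    mvfderiv I' (fun z => g (f z)) x X = mvfderiv I g (f x) (mfderiv I' I f x X) := by
  subst hy
  exact mfderiv_comp_apply x hg hf X

theorem mvfderiv_congr {f g : M → F} {x : M} (h : f =ᶠ[𝓝 x] g) (X : TangentSpace I x) :
    mvfderiv I f x X = mvfderiv I g x X :=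
  DFunLike.congr_fun h.mfderiv_eq X

end Derivatives

/-! ### Flat gauges, and the connection in flat coordinates -/

namespace DescendedBundle

variable {n : ℕ} {Γ : Subgroup (SOo n)} {V : Type u} [NormedAddCommGroup V] [NormedSpace ℝ V]
  (D : DescendedBundle Γ V)

/-- A smooth change of frame `T`, with pointwise inverse `S`, after which the transition maps of the
bundle become the constant maps `C γ`. -/
structure IsFlatGauge (T S : HypSpace n → V →L[ℝ] V) (C : Γ → V →L[ℝ] V) : Prop where
  contMDiff : ContMDiff (𝓡 n) 𝓘(ℝ, V →L[ℝ] V) ∞ T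
  contMDiff_inv : ContMDiff (𝓡 n) 𝓘(ℝ, V →L[ℝ] V) ∞ S
  inv_apply : ∀ x v, S x (T x v) = v
  apply_inv : ∀ x v, T x (S x v) = v
  equivariant : ∀ γ x v, T (γ • x) (D.change γ x v) = C γ (T x v)

/-- Both sides are the coordinates, in the frame at `γ • x`, of one and the same vector of the
fibre. -/
theorem coords_smul_point (s : Π m, D.Fib m) (γ : Γ) (x : HypSpace n) :
    D.coords s (γ • x) = D.change γ x (D.coords s x) := by
  have h' : quotProj Γ (γ • x) = quotProj Γ x := quotProj_smul Γ γ x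
  apply (D.fibLin (γ • x) (quotProj Γ x) h').injective
  rw [D.fibLin_coords _ _ _ h', D.fibLin_change _ _ rfl, D.fibLin_coords _ _ _ rfl]

variable {D}

/-- The frame corrected by `S` has constant transition maps. This is what makes constructions
carried out at one point over `m` independent of that point. -/
theorem IsFlatGauge.fibLin_smul {T S : HypSpace n → V →L[ℝ] V} {C : Γ → V →L[ℝ] V}
    (hT : D.IsFlatGauge T S C) (γ : Γ) (x : HypSpace n) (m : QuotMfd Γ) (h : quotProj Γ x = m)
    (h' : quotProj Γ (γ • x) = m) (w : V) :
    D.fibLin (γ • x) m h' (S (γ • x) (C γ w)) = D.fibLin x m h (S x w) := by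
  rw [← D.fibLin_change x m h γ h', ← hT.inv_apply (γ • x) (D.change γ x (S x w)),
    hT.equivariant, hT.apply_inv]

variable (D)

/-- The coordinates of a section in the frame changed by `T`. -/
def flatCoords (T : HypSpace n → V →L[ℝ] V) (s : Π m, D.Fib m) (x : HypSpace n) : V :=
  T x (D.coords s x)

variable {D}

theorem IsFlatGauge.flatCoords_smul {T S : HypSpace n → V →L[ℝ] V} {C : Γ → V →L[ℝ] V}
    (hT : D.IsFlatGauge T S C) (s : Π m, D.Fib m) (γ : Γ) (x : HypSpace n) :
    D.flatCoords T s (γ • x) = C γ (D.flatCoords T s x) := by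
  rw [flatCoords, coords_smul_point, hT.equivariant, flatCoords]

theorem IsFlatGauge.fibLin_flatCoords {T S : HypSpace n → V →L[ℝ] V} {C : Γ → V →L[ℝ] V}
    (hT : D.IsFlatGauge T S C) (s : Π m, D.Fib m) (x : HypSpace n) (m : QuotMfd Γ)
    (h : quotProj Γ x = m) :
    D.fibLin x m h (S x (D.flatCoords T s x)) = s m := by
  rw [flatCoords, hT.inv_apply, D.fibLin_coords]

theorem IsFlatGauge.coords_eq {T S : HypSpace n → V →L[ℝ] V} {C : Γ → V →L[ℝ] V}
    (hT : D.IsFlatGauge T S C) (s : Π m, D.Fib m) :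
    D.coords s = fun x => S x (D.flatCoords T s x) :=
  funext fun x => (hT.inv_apply x _).symm

theorem IsFlatGauge.flatCoords_eq_of_fibLin {T S : HypSpace n → V →L[ℝ] V} {C : Γ → V →L[ℝ] V}
    (hT : D.IsFlatGauge T S C) (s : Π m, D.Fib m) (x : HypSpace n) (w : V)
    (h : s (quotProj Γ x) = D.fibLin x (quotProj Γ x) rfl (S x w)) :
    D.flatCoords T s x = w := by
  rw [flatCoords, coords, h, ContinuousLinearEquiv.symm_apply_apply, hT.apply_inv]

theorem IsFlatGauge.mdifferentiableAt_coords {T S : HypSpace n → V →L[ℝ] V} {C : Γ → V →L[ℝ] V}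
    (hT : D.IsFlatGauge T S C) {s : Π m, D.Fib m} {x : HypSpace n}
    (hs : MDifferentiableAt (𝓡 n) 𝓘(ℝ, V) (D.flatCoords T s) x) :
    MDifferentiableAt (𝓡 n) 𝓘(ℝ, V) (D.coords s) x := by
  rw [hT.coords_eq s]
  exact ((hT.contMDiff_inv x).mdifferentiableAt (by simp)).clm_apply hs

variable [IsTorsionFreeDiscrete Γ]

theorem IsFlatGauge.mdifferentiableAt_flatCoords {T S : HypSpace n → V →L[ℝ] V}
    {C : Γ → V →L[ℝ] V} (hT : D.IsFlatGauge T S C) {s : Π m, D.Fib m} {x : HypSpace n}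
    (hs : MDifferentiableAt (𝓡 n) ((𝓡 n).prod 𝓘(ℝ, V))
      (fun m => TotalSpace.mk' V m (s m)) (quotProj Γ x)) :
    MDifferentiableAt (𝓡 n) 𝓘(ℝ, V) (D.flatCoords T s) x :=
  ((hT.contMDiff x).mdifferentiableAt (by simp)).clm_apply (D.mdifferentiableAt_coords hs)

/-- Near `y` the local section through `y` inverts the projection, and the local section through `x`
differs from it by a locally constant deck transformation. -/
theorem localSec_comp_quotProj (x y : HypSpace n) {m : QuotMfd Γ}
    (hm : m ∈ (localSec Γ x).source) (hy : quotProj Γ y = m) :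
    ∃ γ : Γ, γ • y = localSec Γ x m ∧ ∀ᶠ z in 𝓝 y, localSec Γ x (quotProj Γ z) = γ • z := by
  subst hy
  obtain ⟨γ, hγ⟩ := localSec_change Γ y x (localSec_mem Γ y) hm
  have hc : ContinuousAt (quotProj Γ) y := (quotProj_isLocalHomeomorph Γ).continuous.continuousAt
  have h : ∀ᶠ z in 𝓝 y, localSec Γ x (quotProj Γ z) = γ • z := by
    filter_upwards [hc.eventually hγ, (localSec Γ y).open_target.mem_nhds
      ((quotProj_isLocalHomeomorph Γ).self_mem_localInverseAt_target (x := y))] with z h1 h2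
    rw [h1, ← localSec_symm_apply Γ y, (localSec Γ y).right_inv h2]
  exact ⟨γ, h.self_of_nhds.symm, h⟩

/-- The connection with connection form `T⁻¹ dT` is the trivial connection in the frame changed by
`T`. -/
theorem IsFlatGauge.conn_apply {T S : HypSpace n → V →L[ℝ] V} {C : Γ → V →L[ℝ] V}
    (hT : D.IsFlatGauge T S C)
    {B : ∀ x : HypSpace n, TangentSpace (𝓡 n) x →L[ℝ] (V →L[ℝ] V)}
    (hB : ∀ x X v, B x X v = S x (mvfderiv (𝓡 n) T x X v))
    {s : Π m, D.Fib m} {m : QuotMfd Γ} {y : HypSpace n} (hy : quotProj Γ y = m)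
    (hs : ∀ z, quotProj Γ z = m → MDifferentiableAt (𝓡 n) 𝓘(ℝ, V) (D.flatCoords T s) z)
    (X : TangentSpace (𝓡 n) y) (X' : TangentSpace (𝓡 n) m)
    (hX : X' = mfderiv (𝓡 n) (𝓡 n) (quotProj Γ) y X) :
    D.conn B s m X' = D.fibLin y m hy (S y (mvfderiv (𝓡 n) (D.flatCoords T s) y X)) := by
  have hm := lift_mem m
  obtain ⟨γ, hγ, hev⟩ := localSec_comp_quotProj (lift m) y hm hy
  have hq : quotProj Γ (γ • y) = m := (quotProj_smul Γ γ y).trans hy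
  have hsec : MDifferentiableAt (𝓡 n) (𝓡 n) (localSec Γ (lift m)) m :=
    ((localSec_contMDiffOn Γ (lift m)).contMDiffAt
      ((localSec Γ (lift m)).open_source.mem_nhds hm)).mdifferentiableAt (by simp)
  have hproj : MDifferentiableAt (𝓡 n) (𝓡 n) (quotProj Γ) y :=
    (quotProj_contMDiff Γ).mdifferentiableAt (by simp)
  have hact : MDifferentiableAt (𝓡 n) (𝓡 n) (fun z : HypSpace n => γ • z) y :=
    (SOo.contMDiff_smul γ.1).mdifferentiableAt (by simp)
  -- `conn` differentiates at a chosen point over `m`, whereas the claim is about `y`; this is why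
  -- `hs` ranges over all points above `m`.
  have hF : MDifferentiableAt (𝓡 n) 𝓘(ℝ, V) (D.flatCoords T s) (localSec Γ (lift m) m) :=
    hs _ (quotProj_localSec Γ _ hm)
  have hf := hT.mdifferentiableAt_coords hF
  set Z := mfderiv (𝓡 n) (𝓡 n) (localSec Γ (lift m)) m X'
  have e1 : mvfderiv (𝓡 n) (D.localCoords s m) m X' =
      mvfderiv (𝓡 n) (D.coords s) (localSec Γ (lift m) m) Z :=
    mvfderiv_comp_map (f := localSec Γ (lift m)) m rfl hf hsec X'
  have e2 : mvfderiv (𝓡 n) (D.flatCoords T s) (localSec Γ (lift m) m) Z =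
      mvfderiv (𝓡 n) T (localSec Γ (lift m) m) Z (D.localCoords s m m) +
        T (localSec Γ (lift m) m) (mvfderiv (𝓡 n) (D.coords s) (localSec Γ (lift m) m) Z) :=
    mvfderiv_clm_apply ((hT.contMDiff _).mdifferentiableAt (by simp)) hf Z
  -- Near `y` the projection followed by the local section is `γ`, so differentiating the
  -- equivariance of the flat coordinates carries the derivative at `y` to the chosen point. As `C
  -- γ` is constant, no extra term appears.
  have e3 : mvfderiv (𝓡 n) (D.flatCoords T s) (localSec Γ (lift m) m) Z =
      C γ (mvfderiv (𝓡 n) (D.flatCoords T s) y X) := by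
    rw [← mvfderiv_comp_clm (C γ) (hs y hy) X]
    have e4 : (fun z => C γ (D.flatCoords T s z)) =ᶠ[𝓝 y]
        fun z => D.flatCoords T s (localSec Γ (lift m) (quotProj Γ z)) := by
      filter_upwards [hev] with z hz
      rw [hz, hT.flatCoords_smul]
    rw [mvfderiv_congr e4 X]
    subst hy
    refine Eq.trans ?_ (mvfderiv_comp_map (g := D.flatCoords T s)
      (f := fun z => localSec Γ (lift (quotProj Γ y)) (quotProj Γ z)) y rfl hF
      (hsec.comp y hproj) X).symm
    have e5 := mfderiv_comp_apply (I := 𝓡 n) (I' := 𝓡 n) (I'' := 𝓡 n) y hsec hproj X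
    rw [← hX] at e5
    exact congrArg _ e5.symm
  have e6 : D.conn B s m X' = D.fibLin (localSec Γ (lift m) m) m (quotProj_localSec Γ _ hm)
      (mvfderiv (𝓡 n) (D.localCoords s m) m X' +
        B (localSec Γ (lift m) m) Z (D.localCoords s m m)) := rfl
  -- Applying `S` to the product rule `d(T f) = dT f + T df` gives `S dT f + df`, and `hB`
  -- identifies the first term with `B f`.
  have e7 : mvfderiv (𝓡 n) (D.localCoords s m) m X' +
      B (localSec Γ (lift m) m) Z (D.localCoords s m m) =
      S (localSec Γ (lift m) m) (C γ (mvfderiv (𝓡 n) (D.flatCoords T s) y X)) := by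
    rw [← e3, e2, map_add, hT.inv_apply, hB, e1, add_comm]
  rw [e6, e7]
  -- `fibLin` carries a proof that its point lies over `m`, so the point is made a variable before
  -- `hγ` is substituted.
  have e8 : ∀ (z : HypSpace n) (hz : quotProj Γ z = m) (w : V), γ • y = z →
      D.fibLin z m hz (S z (C γ w)) = D.fibLin y m hy (S y w) := by
    rintro z hz w rfl
    exact hT.fibLin_smul γ y m hy hz w
  exact e8 _ _ _ hγ

end DescendedBundle

/-! ### Second derivatives and the Lie bracket -/

section Calculus

variable {E : Type*} [NormedAddCommGroup E] [NormedSpace ℝ E]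
  {F : Type*} [NormedAddCommGroup F] [NormedSpace ℝ F]

/-- The commutator of two directional derivatives is the derivative along the Lie bracket. -/
theorem fderiv_fderiv_apply_sub_comm {G : E → F} {X Y : E → E} {u : E}
    (hG : ContDiffAt ℝ 2 G u) (hX : DifferentiableAt ℝ X u) (hY : DifferentiableAt ℝ Y u) :
    fderiv ℝ (fun v => fderiv ℝ G v (Y v)) u (X u) -
      fderiv ℝ (fun v => fderiv ℝ G v (X v)) u (Y u) =
      fderiv ℝ G u (VectorField.lieBracket ℝ X Y u) := by
  have h1 : DifferentiableAt ℝ (fderiv ℝ G) u :=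
    (hG.fderiv_right (m := 1) (by norm_num)).differentiableAt (by simp)
  have h2 := (hG.isSymmSndFDerivAt (by simp)).eq (X u) (Y u)
  -- The Leibniz rule produces two second-derivative terms, equal by the symmetry `h2`. What remains
  -- is the derivative of `G` on `DY(X) - DX(Y)`, the bracket.
  rw [fderiv_clm_apply h1 hY, fderiv_clm_apply h1 hX, VectorField.lieBracket]
  simp only [_root_.add_apply, ContinuousLinearMap.comp_apply, ContinuousLinearMap.flip_apply,
    map_sub, h2]
  abel

end Calculus

/-! ### Invertibility of the derivative of a locally invertible map -/

section Invertible

variable {E : Type*} [NormedAddCommGroup E] [NormedSpace ℝ E]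
  {H : Type*} [TopologicalSpace H] {I : ModelWithCorners ℝ E H}
  {M : Type*} [TopologicalSpace M] [ChartedSpace H M]
  {E' : Type*} [NormedAddCommGroup E'] [NormedSpace ℝ E']
  {H' : Type*} [TopologicalSpace H'] {I' : ModelWithCorners ℝ E' H'}
  {M' : Type*} [TopologicalSpace M'] [ChartedSpace H' M']

/-- Chain rule for `g ∘ f`, which is the identity near `x`. The point `y` is separate from `f x`
because, when the roles of the two maps are exchanged, the base points agree only by a proof. -/
theorem mfderiv_comp_eq_id {f : M → M'} {g : M' → M} {x : M} {y : M'} (hy : f x = y)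
    (hf : MDifferentiableAt I I' f x) (hg : MDifferentiableAt I' I g y)
    (hgf : ∀ᶠ z in 𝓝 x, g (f z) = z) (X : TangentSpace I x) :
    mfderiv I' I g y (mfderiv I I' f x X) = X := by
  subst hy
  have h1 := mfderiv_comp_apply x hg hf X
  have h2 : g ∘ f =ᶠ[𝓝 x] id := hgf
  have h3 : mfderiv I I (g ∘ f) x = mfderiv I I id x := h2.mfderiv_eq
  have h4 := DFunLike.congr_fun (h3.trans mfderiv_id) X
  exact h1.symm.trans h4

/-- Only local inverses are required, since the map in view is a covering and need not be injective.
-/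
theorem isInvertible_mfderiv_of_eventually_inverse {f : M → M'} {g : M' → M} {x : M}
    (hf : MDifferentiableAt I I' f x) (hg : MDifferentiableAt I' I g (f x))
    (hgf : ∀ᶠ z in 𝓝 x, g (f z) = z) (hfg : ∀ᶠ z in 𝓝 (f x), f (g z) = z) :
    (mfderiv I I' f x).IsInvertible := by
  have hx : g (f x) = x := hgf.self_of_nhds
  refine ContinuousLinearMap.IsInvertible.of_inverse (g := mfderiv I' I g (f x)) ?_ ?_
  · ext X
    exact mfderiv_comp_eq_id hx hg hf hfg X
  · ext X
    exact mfderiv_comp_eq_id rfl hf hg hgf X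

end Invertible

/-! ### Parametrisation of `M` by `ℝⁿ` -/

section Parametrization

variable {n : ℕ}

/-- The global parametrisation of `ℍⁿ` by `ℝⁿ`. -/
def HypSpace.param (n : ℕ) : EuclideanSpace ℝ (Fin n) → HypSpace n :=
  (chartAt (EuclideanSpace ℝ (Fin n)) (Classical.arbitrary (HypSpace n))).symm

/-- The global chart of `ℍⁿ`. -/
def HypSpace.globalChart (n : ℕ) : HypSpace n → EuclideanSpace ℝ (Fin n) :=
  chartAt (EuclideanSpace ℝ (Fin n)) (Classical.arbitrary (HypSpace n))

theorem HypSpace.contMDiff_param : ContMDiff (𝓡 n) (𝓡 n) ∞ (HypSpace.param n) :=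
  HypSpace.contMDiffOn_chartAt_symm _

theorem HypSpace.contMDiff_globalChart : ContMDiff (𝓡 n) (𝓡 n) ∞ (HypSpace.globalChart n) :=
  HypSpace.contMDiffOn_chartAt _

theorem HypSpace.param_globalChart (x : HypSpace n) :
    HypSpace.param n (HypSpace.globalChart n x) = x :=
  (chartAt (EuclideanSpace ℝ (Fin n)) (Classical.arbitrary (HypSpace n))).left_inv trivial

theorem HypSpace.globalChart_param (u : EuclideanSpace ℝ (Fin n)) :
    HypSpace.globalChart n (HypSpace.param n u) = u := by
  refine (chartAt (EuclideanSpace ℝ (Fin n)) (Classical.arbitrary (HypSpace n))).right_inv ?_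
  -- The only chart of `ℍⁿ` is `coord`, which is onto `ℝⁿ`.
  have h : (chartAt (EuclideanSpace ℝ (Fin n)) (Classical.arbitrary (HypSpace n))).target = univ :=
    Set.image_univ.trans (HypSpace.coord n).surjective.range_eq
  rw [h]
  trivial

variable (Γ : Subgroup (SOo n))

/-- The parametrisation `ℝⁿ → ℍⁿ → M` of the quotient. -/
def quotParam (v : EuclideanSpace ℝ (Fin n)) : QuotMfd Γ := quotProj Γ (HypSpace.param n v)

theorem quotParam_surjective : Function.Surjective (quotParam Γ) := fun m => by
  obtain ⟨x, rfl⟩ := quotProj_surjective Γ m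
  exact ⟨HypSpace.globalChart n x, congrArg (quotProj Γ) (HypSpace.param_globalChart x)⟩

variable [IsTorsionFreeDiscrete Γ]

theorem contMDiff_quotParam : ContMDiff (𝓡 n) (𝓡 n) ∞ (quotParam Γ) :=
  (quotProj_contMDiff Γ).comp HypSpace.contMDiff_param

theorem localSec_quotProj_eventually (x : HypSpace n) :
    ∀ᶠ z in 𝓝 x, localSec Γ x (quotProj Γ z) = z := by
  filter_upwards [(localSec Γ x).open_target.mem_nhds
      ((quotProj_isLocalHomeomorph Γ).self_mem_localInverseAt_target (x := x))] with z hz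
  rw [← localSec_symm_apply Γ x, (localSec Γ x).right_inv hz]

theorem mdifferentiableAt_localSec (x : HypSpace n) {m : QuotMfd Γ}
    (hm : m ∈ (localSec Γ x).source) : MDifferentiableAt (𝓡 n) (𝓡 n) (localSec Γ x) m :=
  ((localSec_contMDiffOn Γ x).contMDiffAt
    ((localSec Γ x).open_source.mem_nhds hm)).mdifferentiableAt (by simp)

/-- A local inverse is the local section of `ℍⁿ → M` through `param n v`, followed by the global
chart. Invertibility is what allows vector fields on `M` to be pulled back to `ℝⁿ`. -/
theorem isInvertible_mfderiv_quotParam (v : EuclideanSpace ℝ (Fin n)) :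
    (mfderiv (𝓡 n) (𝓡 n) (quotParam Γ) v).IsInvertible := by
  have hm : quotParam Γ v ∈ (localSec Γ (HypSpace.param n v)).source := localSec_mem Γ _
  refine isInvertible_mfderiv_of_eventually_inverse
    (g := fun m => HypSpace.globalChart n (localSec Γ (HypSpace.param n v) m))
    ((contMDiff_quotParam Γ).mdifferentiableAt (by simp)) ?_ ?_ ?_
  · exact (HypSpace.contMDiff_globalChart.mdifferentiableAt (by simp)).comp _
      (mdifferentiableAt_localSec Γ _ hm)
  · filter_upwards [HypSpace.contMDiff_param.continuous.continuousAt.eventually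
      (localSec_quotProj_eventually Γ (HypSpace.param n v))] with w hw
    rw [quotParam, hw, HypSpace.globalChart_param]
  · filter_upwards [(localSec Γ (HypSpace.param n v)).open_source.mem_nhds hm] with m' hm'
    rw [quotParam, HypSpace.param_globalChart, quotProj_localSec Γ _ hm']

end Parametrization

/-! ### Local trivialisations and flatness -/

namespace DescendedBundle

variable {n : ℕ} {Γ : Subgroup (SOo n)} {V : Type u} [NormedAddCommGroup V] [NormedSpace ℝ V]
  (D : DescendedBundle Γ V) [IsTorsionFreeDiscrete Γ]

/-- The local trivialisation of the bundle over the local section of `ℍⁿ → M` through `x`. -/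
def triv (x : HypSpace n) : Trivialization V (π V D.Fib) :=
  D.prebundle.trivializationOfMemPretrivializationAtlas (e := D.pretriv x) ⟨x, rfl⟩

instance (x : HypSpace n) : MemTrivializationAtlas (D.triv x) := ⟨⟨_, ⟨x, rfl⟩, rfl⟩⟩

theorem triv_apply (x : HypSpace n) (m : QuotMfd Γ) (h : m ∈ (localSec Γ x).source)
    (f : D.Fib m) : D.triv x ⟨m, f⟩ =
      (m, (D.fibLin (localSec Γ x m) m (quotProj_localSec Γ x h)).symm f) :=
  D.pretriv_apply x m h f

theorem triv_coords (s : Π m, D.Fib m) (x : HypSpace n) (m : QuotMfd Γ)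
    (h : m ∈ (localSec Γ x).source) : (D.triv x ⟨m, s m⟩).2 = D.coords s (localSec Γ x m) := by
  rw [D.triv_apply x m h]
  exact (ContinuousLinearEquiv.symm_apply_eq _).2 (D.fibLin_coords s _ m _).symm

/-- Near `x` the function `coords s` is the section read in the trivialisation `triv x` and composed
with the projection, because the local section through `x` undoes the projection there. -/
theorem contMDiff_coords {s : Π m, D.Fib m}
    (hs : ContMDiff (𝓡 n) ((𝓡 n).prod 𝓘(ℝ, V)) ∞ (fun m => TotalSpace.mk' V m (s m))) :
    ContMDiff (𝓡 n) 𝓘(ℝ, V) ∞ (D.coords s) := by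
  intro x
  have hx : quotProj Γ x ∈ (localSec Γ x).source := localSec_mem Γ x
  have h1 : ContMDiffAt (𝓡 n) 𝓘(ℝ, V) ∞ (fun m => (D.triv x ⟨m, s m⟩).2) (quotProj Γ x) :=
    ((D.triv x).contMDiffAt_section_iff hx).1 (hs _)
  refine (h1.comp x (quotProj_contMDiff Γ x)).congr_of_eventuallyEq ?_
  have hc : ContinuousAt (quotProj Γ) x := (quotProj_isLocalHomeomorph Γ).continuous.continuousAt
  filter_upwards [hc.eventually ((localSec Γ x).open_source.mem_nhds hx),
    localSec_quotProj_eventually Γ x] with y h3 h4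
  rw [Function.comp_apply, D.triv_coords s x _ h3, h4]

variable {D} {T S : HypSpace n → V →L[ℝ] V} {C : Γ → V →L[ℝ] V}
  {B : ∀ x : HypSpace n, TangentSpace (𝓡 n) x →L[ℝ] (V →L[ℝ] V)}

theorem IsFlatGauge.contMDiff_flatCoords (hT : D.IsFlatGauge T S C) {s : Π m, D.Fib m}
    (hs : ContMDiff (𝓡 n) ((𝓡 n).prod 𝓘(ℝ, V)) ∞ (fun m => TotalSpace.mk' V m (s m))) :
    ContMDiff (𝓡 n) 𝓘(ℝ, V) ∞ (D.flatCoords T s) :=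
  hT.contMDiff.clm_apply (D.contMDiff_coords hs)

/-- The connection in the local parametrisation of `M` by `ℝⁿ`. -/
theorem IsFlatGauge.conn_quotParam (hT : D.IsFlatGauge T S C)
    (hB : ∀ x X v, B x X v = S x (mvfderiv (𝓡 n) T x X v)) {s : Π m, D.Fib m}
    (hs : MDifferentiable (𝓡 n) 𝓘(ℝ, V) (D.flatCoords T s)) (u : EuclideanSpace ℝ (Fin n))
    (X : Π m : QuotMfd Γ, TangentSpace (𝓡 n) m) :
    D.conn B s (quotParam Γ u) (X (quotParam Γ u)) = D.fibLin (HypSpace.param n u) _ rfl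
      (S (HypSpace.param n u) (fderiv ℝ (fun v => D.flatCoords T s (HypSpace.param n v)) u
        (VectorField.mpullback (𝓡 n) (𝓡 n) (quotParam Γ) X u))) := by
  have h1 : MDifferentiableAt (𝓡 n) (𝓡 n) (HypSpace.param n) u :=
    HypSpace.contMDiff_param.mdifferentiableAt (by simp)
  have h2 : MDifferentiableAt (𝓡 n) (𝓡 n) (quotProj Γ) (HypSpace.param n u) :=
    (quotProj_contMDiff Γ).mdifferentiableAt (by simp)
  set w := VectorField.mpullback (𝓡 n) (𝓡 n) (quotParam Γ) X u with hw
  -- The pulled-back vector `w` is the image of `X` under the inverse of the derivative of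
  -- `quotParam`. That derivative is invertible, so it sends `w` back to `X`.
  have h3 : X (quotParam Γ u) = mfderiv (𝓡 n) (𝓡 n) (quotProj Γ) (HypSpace.param n u)
      (mfderiv (𝓡 n) (𝓡 n) (HypSpace.param n) u w) := by
    refine Eq.trans ?_ (mfderiv_comp_apply u h2 h1 w)
    rw [hw, VectorField.mpullback_apply]
    exact ((isInvertible_mfderiv_quotParam Γ u).self_apply_inverse _).symm
  refine (hT.conn_apply hB rfl (fun z _ => hs z) _ _ h3).trans ?_
  have h4 := mvfderiv_comp_map (g := D.flatCoords T s) (f := HypSpace.param n) u rfl (hs _) h1 w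
  rw [← h4, mvfderiv, mfderiv_eq_fderiv]
  rfl

/-- In flat coordinates over `ℝⁿ` a section is a function `G` and covariant differentiation along
`Z` is the directional derivative along the pull-back of `Z`. The curvature then vanishes because
the commutator of two directional derivatives is the derivative along the bracket. -/
theorem IsFlatGauge.isFlat_conn (hT : D.IsFlatGauge T S C)
    (hB : ∀ x X v, B x X v = S x (mvfderiv (𝓡 n) T x X v)) : IsFlat (D.conn B) := by
  intro X Y s hX hY hs m
  obtain ⟨u, rfl⟩ := quotParam_surjective Γ m
  set G : EuclideanSpace ℝ (Fin n) → V := fun v => D.flatCoords T s (HypSpace.param n v)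
  have hF : ContMDiff (𝓡 n) 𝓘(ℝ, V) ∞ (D.flatCoords T s) := hT.contMDiff_flatCoords hs
  have hFd : MDifferentiable (𝓡 n) 𝓘(ℝ, V) (D.flatCoords T s) := hF.mdifferentiable (by simp)
  have hG : ContDiff ℝ ∞ G := contMDiff_iff_contDiff.1 (hF.comp HypSpace.contMDiff_param)
  have pull : ∀ Z : Π m : QuotMfd Γ, TangentSpace (𝓡 n) m,
      ContMDiff (𝓡 n) (𝓡 n).tangent ∞
        (fun m => TotalSpace.mk' (EuclideanSpace ℝ (Fin n)) m (Z m)) → ∀ v,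
      DifferentiableAt ℝ (VectorField.mpullback (𝓡 n) (𝓡 n) (quotParam Γ) Z :
        EuclideanSpace ℝ (Fin n) → EuclideanSpace ℝ (Fin n)) v := by
    intro Z hZ v
    -- Class `C¹` suffices, since only first derivatives of the pulled-back fields enter.
    have h := ContMDiffAt.mpullback_vectorField_preimage (n := ∞) (m := 1) (x₀ := v)
      ((hZ _).of_le (by simp)) (contMDiff_quotParam Γ v) (isInvertible_mfderiv_quotParam Γ v)
      (by norm_cast)
    exact (contMDiffAt_vectorSpace_iff_contDiffAt.1 h).differentiableAt (by simp)
  have hcov : ∀ Z : Π m : QuotMfd Γ, TangentSpace (𝓡 n) m, ∀ v,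
      D.flatCoords T (fun m' => D.conn B s m' (Z m')) (HypSpace.param n v) =
        fderiv ℝ G v (VectorField.mpullback (𝓡 n) (𝓡 n) (quotParam Γ) Z v) := fun Z v =>
    hT.flatCoords_eq_of_fibLin _ _ _ (hT.conn_quotParam hB hFd v Z)
  -- Differentiating covariantly a second time requires differentiability of the new flat
  -- coordinates on `ℍⁿ`. It is obtained on `ℝⁿ` from the formula `hcov` and moved to `ℍⁿ` by the
  -- global chart.
  have hcovd : ∀ Z : Π m : QuotMfd Γ, TangentSpace (𝓡 n) m,
      ContMDiff (𝓡 n) (𝓡 n).tangent ∞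
        (fun m => TotalSpace.mk' (EuclideanSpace ℝ (Fin n)) m (Z m)) →
      MDifferentiable (𝓡 n) 𝓘(ℝ, V) (D.flatCoords T (fun m' => D.conn B s m' (Z m'))) := by
    intro Z hZ
    have h1 : Differentiable ℝ (fun v => fderiv ℝ G v
        (VectorField.mpullback (𝓡 n) (𝓡 n) (quotParam Γ) Z v)) := fun v =>
      ((hG.fderiv_right (m := 1) (by norm_cast)).differentiable (by simp) v).clm_apply (pull Z hZ v)
    have h2 := h1.mdifferentiable.comp
      ((HypSpace.contMDiff_globalChart (n := n)).mdifferentiable (by simp))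
    have h3 : D.flatCoords T (fun m' => D.conn B s m' (Z m')) =
        (fun v => fderiv ℝ G v (VectorField.mpullback (𝓡 n) (𝓡 n) (quotParam Γ) Z v)) ∘
          HypSpace.globalChart n := by
      funext x
      rw [Function.comp_apply, ← hcov Z, HypSpace.param_globalChart]
    rw [h3]
    exact h2
  -- Pull-back commutes with brackets, and on the vector space `ℝⁿ` the manifold bracket is the
  -- ordinary one.
  have hbr : VectorField.mpullback (𝓡 n) (𝓡 n) (quotParam Γ)
      (VectorField.mlieBracket (𝓡 n) X Y) u = VectorField.lieBracket ℝ
        (VectorField.mpullback (𝓡 n) (𝓡 n) (quotParam Γ) X)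
        (VectorField.mpullback (𝓡 n) (𝓡 n) (quotParam Γ) Y) u := by
    have : IsManifold (𝓡 n) (minSmoothness ℝ 2) (QuotMfd Γ) :=
      IsManifold.of_le (n := ∞) (by simp; norm_cast)
    rw [VectorField.mpullback_mlieBracket (n := ∞) ((hX _).mdifferentiableAt (by simp))
      ((hY _).mdifferentiableAt (by simp)) (contMDiff_quotParam Γ u) (by simp; norm_cast),
      ← VectorField.mlieBracketWithin_univ, VectorField.mlieBracketWithin_eq_lieBracketWithin]
    exact congrFun VectorField.lieBracketWithin_univ u
  rw [hT.conn_quotParam hB (hcovd Y hY) u X, hT.conn_quotParam hB (hcovd X hX) u Y,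
    hT.conn_quotParam hB hFd u (VectorField.mlieBracket (𝓡 n) X Y), hbr,
    ← fderiv_fderiv_apply_sub_comm (hG.contDiffAt.of_le (by norm_cast)) (pull X hX u)
      (pull Y hY u)]
  simp only [hcov, map_sub]
  exact sub_self _

/-! ### Smoothness of the connection -/

section Smooth

variable {n : ℕ} {Γ : Subgroup (SOo n)} {V : Type u} [NormedAddCommGroup V] [NormedSpace ℝ V]
  {D : DescendedBundle Γ V} [IsTorsionFreeDiscrete Γ] {T S : HypSpace n → V →L[ℝ] V}
  {C : Γ → V →L[ℝ] V} {B : ∀ x : HypSpace n, TangentSpace (𝓡 n) x →L[ℝ] (V →L[ℝ] V)}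

variable (D) in
-- The preferred trivialisation at `m₀` is the one over the local section through `lift m₀`.
theorem continuousLinearMapAt_trivializationAt (m₀ m : QuotMfd Γ)
    (h : m ∈ (localSec Γ (lift m₀)).source) (f : D.Fib m) :
    (trivializationAt V D.Fib m₀).continuousLinearMapAt ℝ m f =
      (D.fibLin (localSec Γ (lift m₀) m) m (quotProj_localSec Γ _ h)).symm f := by
  rw [Trivialization.continuousLinearMapAt_apply, Trivialization.linearMapAt_apply,
    if_pos (show m ∈ (trivializationAt V D.Fib m₀).baseSet from h)]
  exact congrArg Prod.snd (D.triv_apply (lift m₀) m h f)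

/-- The connection in the frame over a local section of `ℍⁿ → M`. -/
theorem IsFlatGauge.conn_localSec (hT : D.IsFlatGauge T S C)
    (hB : ∀ x X v, B x X v = S x (mvfderiv (𝓡 n) T x X v)) {s : Π m, D.Fib m}
    (hs : MDifferentiable (𝓡 n) 𝓘(ℝ, V) (D.flatCoords T s)) (x : HypSpace n) {m : QuotMfd Γ}
    (hm : m ∈ (localSec Γ x).source) (X : TangentSpace (𝓡 n) m) :
    D.conn B s m X = D.fibLin (localSec Γ x m) m (quotProj_localSec Γ x hm)
      (S (localSec Γ x m)
        (mvfderiv (𝓡 n) (fun m' => D.flatCoords T s (localSec Γ x m')) m X)) := by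
  have h1 := mdifferentiableAt_localSec Γ x hm
  have h2 : ∀ᶠ m' in 𝓝 m, quotProj Γ (localSec Γ x m') = m' := by
    filter_upwards [(localSec Γ x).open_source.mem_nhds hm] with m' hm'
    exact quotProj_localSec Γ x hm'
  have h3 := mfderiv_comp_eq_id rfl h1
    ((quotProj_contMDiff Γ).mdifferentiableAt (I := 𝓡 n) (I' := 𝓡 n) (by simp)) h2 X
  refine (hT.conn_apply hB (quotProj_localSec Γ x hm) (fun z _ => hs z) _ X h3.symm).trans ?_
  rw [mvfderiv_comp_map (g := D.flatCoords T s) (f := localSec Γ x) m rfl (hs _) h1 X]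

/-- Over a local section, `X ↦ ∇_X s` has coordinates `S` composed with the derivative of the flat
coordinates, and both factors are smooth. -/
theorem IsFlatGauge.contMDiffCovariantDerivative_conn (hT : D.IsFlatGauge T S C)
    (hB : ∀ x X v, B x X v = S x (mvfderiv (𝓡 n) T x X v)) :
    (D.conn B).ContMDiffCovariantDerivative ∞ := by
  refine ⟨⟨fun {s} hs => ?_⟩⟩
  have hs' : ContMDiff (𝓡 n) ((𝓡 n).prod 𝓘(ℝ, V)) ∞ (fun m => TotalSpace.mk' V m (s m)) :=
    (contMDiffOn_univ.1 hs).of_le (by simp)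
  have hF : ContMDiff (𝓡 n) 𝓘(ℝ, V) ∞ (D.flatCoords T s) := hT.contMDiff_flatCoords hs'
  rw [contMDiffOn_univ]
  intro m
  refine (contMDiffAt_hom_bundle _).2 ⟨contMDiffAt_id, ?_⟩
  have hm : m ∈ (localSec Γ (lift m)).source := lift_mem m
  have h1 : ContMDiffAt (𝓡 n) (𝓡 n) ∞ (localSec Γ (lift m)) m :=
    (localSec_contMDiffOn Γ (lift m)).contMDiffAt ((localSec Γ (lift m)).open_source.mem_nhds hm)
  have h2 := ContMDiffAt.mfderiv_const (m := ∞) ((hF _).comp m h1) (by simp)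
  have h3 := ((hT.contMDiff_inv _).comp m h1).clm_comp h2
  refine h3.congr_of_eventuallyEq ?_
  filter_upwards [(localSec Γ (lift m)).open_source.mem_nhds hm] with m' hm'
  ext w
  -- Both sides involve the same trivialisation of the tangent bundle of `M`. On the target, the one
  -- for a `V`-valued map is the identity, and the one for the fibre cancels `fibLin`.
  simp only [inTangentCoordinates, ContinuousLinearMap.inCoordinates,
    ContinuousLinearMap.comp_apply]
  rw [TangentBundle.continuousLinearMapAt_model_space,
    D.continuousLinearMapAt_trivializationAt m m' hm',
    hT.conn_localSec hB (hF.mdifferentiable (by simp)) (lift m) hm',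
    ContinuousLinearEquiv.symm_apply_apply]
  rfl

end Smooth

/-! ### The isomorphism induced by an intertwining map -/

section Iso

universe v

variable {n : ℕ} {Γ : Subgroup (SOo n)}
  {V : Type u} [NormedAddCommGroup V] [NormedSpace ℝ V]
  {W : Type v} [NormedAddCommGroup W] [NormedSpace ℝ W]
  {D : DescendedBundle Γ V} {T S : HypSpace n → V →L[ℝ] V} {C : Γ → V →L[ℝ] V}
  {D' : DescendedBundle Γ W} {T' S' : HypSpace n → W →L[ℝ] W} {C' : Γ → W →L[ℝ] W}

/-- The linear homeomorphism given by a gauge at a point. -/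
def IsFlatGauge.equiv (hT : D.IsFlatGauge T S C) (x : HypSpace n) : V ≃L[ℝ] V :=
  ContinuousLinearEquiv.equivOfInverse (T x) (S x) (hT.inv_apply x) (hT.apply_inv x)

/-- The isomorphism of the fibres which is `θ` in flat coordinates. -/
def IsFlatGauge.iso (hT : D.IsFlatGauge T S C) (hT' : D'.IsFlatGauge T' S' C') (θ : V ≃L[ℝ] W)
    (m : QuotMfd Γ) : D.Fib m ≃L[ℝ] D'.Fib m :=
  ((D.fibLin (lift m) m (quotProj_lift m)).symm.trans
    ((hT.equiv (lift m)).trans (θ.trans (hT'.equiv (lift m)).symm))).trans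
      (D'.fibLin (lift m) m (quotProj_lift m))

/-- `iso` is defined through one chosen point over `m`. Since `θ` intertwines the constant
transition maps `C` and `C'`, it has the same expression at every other point over `m`. -/
theorem IsFlatGauge.iso_fibLin (hT : D.IsFlatGauge T S C) (hT' : D'.IsFlatGauge T' S' C')
    (θ : V ≃L[ℝ] W) (hθ : ∀ γ v, θ (C γ v) = C' γ (θ v)) (x : HypSpace n) (m : QuotMfd Γ)
    (h : quotProj Γ x = m) (v : V) :
    hT.iso hT' θ m (D.fibLin x m h (S x v)) = D'.fibLin x m h (S' x (θ v)) := by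
  obtain ⟨γ, hγ⟩ := (quotProj_eq_iff Γ).1 ((quotProj_lift m).trans h.symm)
  have h1 : ∀ (y : HypSpace n) (hy : quotProj Γ y = m), γ • x = y →
      D'.fibLin y m hy (S' y (θ (T y ((D.fibLin y m hy).symm (D.fibLin x m h (S x v)))))) =
        D'.fibLin x m h (S' x (θ v)) := by
    rintro y hy rfl
    rw [← hT.fibLin_smul γ x m h hy, ContinuousLinearEquiv.symm_apply_apply, hT.apply_inv, hθ,
      hT'.fibLin_smul γ x m h hy]
  exact h1 _ _ hγ

theorem IsFlatGauge.flatCoords_iso (hT : D.IsFlatGauge T S C) (hT' : D'.IsFlatGauge T' S' C')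
    (θ : V ≃L[ℝ] W) (hθ : ∀ γ v, θ (C γ v) = C' γ (θ v)) (s : Π m, D.Fib m) (x : HypSpace n) :
    D'.flatCoords T' (fun m => hT.iso hT' θ m (s m)) x = θ (D.flatCoords T s x) := by
  refine hT'.flatCoords_eq_of_fibLin _ _ _ ?_
  rw [← hT.iso_fibLin hT' θ hθ, hT.fibLin_flatCoords]

variable [IsTorsionFreeDiscrete Γ]

/-- In the trivialisations of both bundles over one local section, the map acts on the fibre
coordinate by `S' θ T`, which depends smoothly on the base point. -/
theorem IsFlatGauge.contMDiff_iso (hT : D.IsFlatGauge T S C) (hT' : D'.IsFlatGauge T' S' C')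
    (θ : V ≃L[ℝ] W) (hθ : ∀ γ v, θ (C γ v) = C' γ (θ v)) :
    ContMDiff ((𝓡 n).prod 𝓘(ℝ, V)) ((𝓡 n).prod 𝓘(ℝ, W)) ∞
      (fun p : TotalSpace V D.Fib => TotalSpace.mk' W p.1 (hT.iso hT' θ p.1 p.2)) := by
  intro p
  have hm : p.1 ∈ (localSec Γ (lift p.1)).source := lift_mem p.1
  have hproj : ContMDiffAt ((𝓡 n).prod 𝓘(ℝ, V)) (𝓡 n) ∞ (fun q : TotalSpace V D.Fib => q.1) p :=
    contMDiff_proj D.Fib p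
  have hmem : TotalSpace.mk' W p.1 (hT.iso hT' θ p.1 p.2) ∈ (D'.triv (lift p.1)).source :=
    (D'.triv (lift p.1)).mem_source.2 hm
  refine ((D'.triv (lift p.1)).contMDiffAt_iff
    (f := fun q : TotalSpace V D.Fib => TotalSpace.mk' W q.1 (hT.iso hT' θ q.1 q.2)) hmem).2
    ⟨hproj, ?_⟩
  have h1 : ContMDiffAt ((𝓡 n).prod 𝓘(ℝ, V)) 𝓘(ℝ, V) ∞
      (fun q : TotalSpace V D.Fib => (D.triv (lift p.1) q).2) p :=
    (((D.triv (lift p.1)).contMDiffAt_iff (f := id)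
      ((D.triv (lift p.1)).mem_source.2 hm)).1 contMDiffAt_id).2
  have h2 : ContMDiffAt (𝓡 n) (𝓡 n) ∞ (localSec Γ (lift p.1)) p.1 :=
    (localSec_contMDiffOn Γ _).contMDiffAt ((localSec Γ (lift p.1)).open_source.mem_nhds hm)
  have h3 := h2.comp p hproj
  have h4 := (((hT'.contMDiff_inv _).comp p h3)).clm_apply
    ((contMDiffAt_const (c := (θ : V →L[ℝ] W))).clm_apply
      (((hT.contMDiff _).comp p h3).clm_apply h1))
  refine h4.congr_of_eventuallyEq ?_
  filter_upwards [hproj.continuousAt.eventually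
    ((localSec Γ (lift p.1)).open_source.mem_nhds hm)] with q hq
  obtain ⟨m, f⟩ := q
  have hq' : m ∈ (localSec Γ (lift p.1)).source := hq
  simp only [Function.comp_apply, ContinuousLinearEquiv.coe_coe]
  rw [D'.triv_apply _ _ hq', D.triv_apply _ _ hq', ContinuousLinearEquiv.symm_apply_eq,
    ← hT.iso_fibLin hT' θ hθ, hT.inv_apply, ContinuousLinearEquiv.apply_symm_apply]

/-- In flat coordinates both connections are the plain derivative and the isomorphism is the
constant map `θ`, which commutes with it. -/
theorem IsFlatGauge.iso_conn (hT : D.IsFlatGauge T S C) (hT' : D'.IsFlatGauge T' S' C')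
    (θ : V ≃L[ℝ] W) (hθ : ∀ γ v, θ (C γ v) = C' γ (θ v))
    {B : ∀ x : HypSpace n, TangentSpace (𝓡 n) x →L[ℝ] (V →L[ℝ] V)}
    (hB : ∀ x X v, B x X v = S x (mvfderiv (𝓡 n) T x X v))
    {B' : ∀ x : HypSpace n, TangentSpace (𝓡 n) x →L[ℝ] (W →L[ℝ] W)}
    (hB' : ∀ x X v, B' x X v = S' x (mvfderiv (𝓡 n) T' x X v))
    (s : Π m, D.Fib m) (m : QuotMfd Γ) (hs : DiffAt Γ s m) (X : TangentSpace (𝓡 n) m) :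
    hT.iso hT' θ m (D.conn B s m X) = D'.conn B' (fun m' => hT.iso hT' θ m' (s m')) m X := by
  have h1 : ∀ z, quotProj Γ z = m → MDifferentiableAt (𝓡 n) 𝓘(ℝ, V) (D.flatCoords T s) z := by
    rintro z rfl
    exact hT.mdifferentiableAt_flatCoords hs
  have h2 : D'.flatCoords T' (fun m' => hT.iso hT' θ m' (s m')) =
      fun x => (θ : V →L[ℝ] W) (D.flatCoords T s x) :=
    funext fun x => hT.flatCoords_iso hT' θ hθ s x
  have hm := lift_mem m
  have hX := mfderiv_comp_eq_id rfl
    (mdifferentiableAt_localSec Γ (lift m) hm)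
    ((quotProj_contMDiff Γ).mdifferentiableAt (I := 𝓡 n) (I' := 𝓡 n) (by simp))
    (by
      filter_upwards [(localSec Γ (lift m)).open_source.mem_nhds hm] with m' hm'
      exact quotProj_localSec Γ _ hm') X
  rw [hT.conn_apply hB (quotProj_localSec Γ _ hm) h1 _ X hX.symm, hT.iso_fibLin hT' θ hθ,
    hT'.conn_apply hB' (quotProj_localSec Γ _ hm) ?_ _ X hX.symm, h2,
    mvfderiv_comp_clm _ (h1 _ (quotProj_localSec Γ _ hm))]
  · rfl
  · intro z hz
    rw [h2]
    exact mdifferentiableAt_const.clm_apply (h1 z hz)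

end Iso

end DescendedBundle

/-! ### The canonical flat bundle -/

section Dev

variable {n : ℕ} (Γ : Subgroup (SOo n)) [IsTorsionFreeDiscrete Γ] {V : Type u}
  [NormedAddCommGroup V] [NormedSpace ℝ V] (μ : SO n →* (V →L[ℝ] V))

/-- The frame `[x, ·]` already has the constant transition maps `dev γ`, so nothing needs
correcting. -/
theorem devBundle_isFlatGauge :
    (devBundle Γ μ).IsFlatGauge (fun _ => 1) (fun _ => 1) (devRep Γ μ) where
  contMDiff := contMDiff_const
  contMDiff_inv := contMDiff_const
  inv_apply _ _ := rfl
  apply_inv _ _ := rfl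
  equivariant _ _ _ := rfl

theorem devConnection_form (x : HypSpace n) (X : TangentSpace (𝓡 n) x) (v : V) :
    (0 : ∀ x : HypSpace n, TangentSpace (𝓡 n) x →L[ℝ] (V →L[ℝ] V)) x X v =
      (1 : V →L[ℝ] V) (mvfderiv (𝓡 n) (fun _ : HypSpace n => (1 : V →L[ℝ] V)) x X v) := by
  rw [mvfderiv_const]
  rfl

theorem isDevConnection_devConnection : IsDevConnection Γ μ (devConnection Γ μ) := by
  intro s f hf x hs
  have hT := devBundle_isFlatGauge Γ μ
  -- The given function `f` is the flat coordinate function of `s`.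
  have hF : (devBundle Γ μ).flatCoords (fun _ => 1) s = f :=
    funext fun y => hT.flatCoords_eq_of_fibLin s y (f y) (hf y)
  have hd : ∀ z, quotProj Γ z = quotProj Γ x →
      MDifferentiableAt (𝓡 n) 𝓘(ℝ, V) ((devBundle Γ μ).flatCoords (fun _ => 1) s) z :=
    fun z hz => hT.mdifferentiableAt_flatCoords (hz ▸ hs)
  refine ⟨hF ▸ hd x rfl, fun X => ?_⟩
  refine (hT.conn_apply (devConnection_form (V := V)) rfl hd X _ rfl).trans ?_
  rw [hF]
  rfl

end Dev

/-! ### Derivatives of a representation and the Maurer–Cartan form -/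

section Representations

variable {n : ℕ} {V : Type u} [NormedAddCommGroup V] [NormedSpace ℝ V] (ρ : SmoothRep n V)

theorem maurerCartan_toMat (g h : SL n) : maurerCartan g h.toMat = (g⁻¹ * h).toMat := rfl

/-- The derivative of a representation at `g` is `ξ ↦ ρ(g) dρ(g⁻¹ ξ)`. -/
theorem SmoothRep.exists_hasFDerivAt (g : SL n) : ∃ K : Mat n → (V →L[ℝ] V),
    HasFDerivAt K (ContinuousLinearMap.compL ℝ V V V (ρ g) ∘L ρ.differential ∘L maurerCartan g)
      g.toMat ∧ ∀ᶠ h : SL n in 𝓝 g, K h.toMat = ρ h := by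
  obtain ⟨h1, h2⟩ := (ρ.smooth 1).choose_spec
  have h0 : maurerCartan g g.toMat = (1 : SL n).toMat := by
    rw [maurerCartan_toMat, inv_mul_cancel]
  have h3 : HasFDerivAt (ρ.smooth 1).choose ρ.differential (maurerCartan g g.toMat) := by
    rw [h0]
    exact (h1.differentiableAt (by simp)).hasFDerivAt
  -- From `ρ(h) = ρ(g) ρ(g⁻¹ h)`: the extension near `g` is the left translate of the one chosen at
  -- the identity, whose derivative is `differential` by definition.
  refine ⟨fun A => ContinuousLinearMap.compL ℝ V V V (ρ g)
    ((ρ.smooth 1).choose (maurerCartan g A)), ?_, ?_⟩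
  · exact (ContinuousLinearMap.compL ℝ V V V (ρ g)).hasFDerivAt.comp g.toMat
      (h3.comp g.toMat (maurerCartan g).hasFDerivAt)
  · have hc : ContinuousAt (fun h : SL n => g⁻¹ * h) g := (continuous_const_mul g⁻¹).continuousAt
    have h4 : ∀ᶠ h : SL n in 𝓝 (g⁻¹ * g), (ρ.smooth 1).choose h.toMat = ρ h := by
      rw [inv_mul_cancel]
      exact h2
    filter_upwards [hc.eventually h4] with h hh
    rw [maurerCartan_toMat, hh, ContinuousLinearMap.compL_apply]
    change ρ g * ρ (g⁻¹ * h) = ρ h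
    rw [← ρ.map_mul, mul_inv_cancel_left]

theorem SmoothRep.hasDerivAt_comp {c : ℝ → SL n} {ξ : Mat n}
    (hc : HasDerivAt (fun t => (c t).toMat) ξ 0) :
    HasDerivAt (fun t => ρ (c t)) (ρ (c 0) * ρ.differential (maurerCartan (c 0) ξ)) 0 := by
  obtain ⟨K, h1, h2⟩ := ρ.exists_hasFDerivAt (c 0)
  refine (h1.comp_hasDerivAt 0 hc).congr_of_eventuallyEq ?_
  have hcont : ContinuousAt c 0 := SL.isInducing_toMat.continuousAt_iff.2 hc.continuousAt
  filter_upwards [hcont.eventually h2] with t ht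
  exact ht.symm

/-- Equivalently, `ρ(f)⁻¹ d(ρ ∘ f) = dρ(ω(df))`, the identity that turns the tractor connection form
into `T⁻¹ dT`. -/
theorem SmoothRep.mvfderiv_comp {f : HypSpace n → SL n} {x : HypSpace n}
    (hf : MDifferentiableAt (𝓡 n) 𝓘(ℝ, Mat n) (fun y => (f y).toMat) x)
    (X : TangentSpace (𝓡 n) x) :
    mvfderiv (𝓡 n) (fun y => ρ (f y)) x X =
      ρ (f x) * ρ.differential (maurerCartan (f x)
        (mvfderiv (𝓡 n) (fun y => (f y).toMat) x X)) := by
  obtain ⟨K, h1, h2⟩ := ρ.exists_hasFDerivAt (f x)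
  have hcont : ContinuousAt f x := SL.isInducing_toMat.continuousAt_iff.2 hf.continuousAt
  have h3 : (fun y => ρ (f y)) =ᶠ[𝓝 x] K ∘ fun y => (f y).toMat := by
    filter_upwards [hcont.eventually h2] with y hy
    exact hy.symm
  rw [mvfderiv_congr h3]
  exact DFunLike.congr_fun (h1.hasMFDerivAt.comp x hf.hasMFDerivAt).mfderiv X

theorem SmoothRep.inverse_apply (g : SL n) : Ring.inverse (ρ g) = ρ g⁻¹ := by
  have h1 : ρ g * ρ g⁻¹ = 1 := by rw [← ρ.map_mul, mul_inv_cancel, ρ.map_one]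
  have h2 : ρ g⁻¹ * ρ g = 1 := by rw [← ρ.map_mul, inv_mul_cancel, ρ.map_one]
  exact Ring.inverse_unit ⟨ρ g, ρ g⁻¹, h1, h2⟩

/-- Inversion in the Banach algebra of operators has derivative `b ↦ -a⁻¹ b a⁻¹` at `a`;
completeness of `V` makes this algebra complete. -/
theorem SmoothRep.hasDerivAt_inv_comp [CompleteSpace V] {c : ℝ → SL n} {ξ : Mat n}
    (hc : HasDerivAt (fun t => (c t).toMat) ξ 0) :
    HasDerivAt (fun t => ρ (c t)⁻¹) (-(ρ.differential (maurerCartan (c 0) ξ) * ρ (c 0)⁻¹)) 0 := by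
  have h1 : ρ (c 0) * ρ (c 0)⁻¹ = 1 := by rw [← ρ.map_mul, mul_inv_cancel, ρ.map_one]
  have h2 : ρ (c 0)⁻¹ * ρ (c 0) = 1 := by rw [← ρ.map_mul, inv_mul_cancel, ρ.map_one]
  have h3 := (hasFDerivAt_ringInverse (𝕜 := ℝ)
    (⟨ρ (c 0), ρ (c 0)⁻¹, h1, h2⟩ : (V →L[ℝ] V)ˣ)).comp_hasDerivAt 0 (ρ.hasDerivAt_comp hc)
  refine (h3.congr_deriv ?_).congr_of_eventuallyEq
    (Eventually.of_forall fun t => (ρ.inverse_apply (c t)).symm)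
  change -(ρ (c 0)⁻¹ * (ρ (c 0) * ρ.differential (maurerCartan (c 0) ξ)) * ρ (c 0)⁻¹) = _
  rw [← mul_assoc, h2, one_mul]

end Representations

/-! ### Differentiability of `G → G / P` over `ℍⁿ` -/

section Projection

variable {n : ℕ}

/-- `rayPoint` picks its scaling factor by choice. The condition `h(x, x) = -1` determines that
factor and gives an expression that can be differentiated. -/
theorem GOver.coe_toHyp (g : GOver n) : (g.toHyp : Fin (n + 1) → ℝ) =
    (√(-lorentz (g.1.1 *ᵥ timeVec n) (g.1.1 *ᵥ timeVec n)))⁻¹ • (g.1.1 *ᵥ timeVec n) := by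
  obtain ⟨h0, h1, -⟩ := g.2.choose_spec
  rw [lorentz_smul_smul] at h1
  change g.2.choose • _ = _
  congr 1
  set a := g.2.choose
  have h2 : -lorentz (g.1.1 *ᵥ timeVec n) (g.1.1 *ᵥ timeVec n) = a⁻¹ ^ 2 := by
    field_simp
    linarith
  rw [h2, Real.sqrt_sq (inv_nonneg.2 h0.le), inv_inv]

theorem GOver.lorentz_neg (g : GOver n) :
    lorentz (g.1.1 *ᵥ timeVec n) (g.1.1 *ᵥ timeVec n) < 0 := by
  obtain ⟨h0, h1, -⟩ := g.2.choose_spec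
  rw [lorentz_smul_smul] at h1
  by_contra h
  have := mul_nonneg (sq_nonneg g.2.choose) (not_lt.1 h)
  linarith

theorem HypSpace.mdifferentiableAt_of_val {f : ℝ → HypSpace n} {t : ℝ}
    (hf : DifferentiableAt ℝ (fun t => (f t : Fin (n + 1) → ℝ)) t) :
    MDifferentiableAt 𝓘(ℝ, ℝ) (𝓡 n) f t := by
  have h1 : DifferentiableAt ℝ (fun t => HypSpace.globalChart n (f t)) t := by
    -- The global chart is the restriction to the sheet of the linear map that forgets the last
    -- coordinate.
    have h2 : ContDiff ℝ 1 (fun x : Fin (n + 1) → ℝ =>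
      (WithLp.toLp 2 (fun i : Fin n => x i.castSucc) : EuclideanSpace ℝ (Fin n))) := by fun_prop
    exact (h2.differentiable (by simp) _).comp t hf
  have h3 : f = HypSpace.param n ∘ fun t => HypSpace.globalChart n (f t) :=
    funext fun t => (HypSpace.param_globalChart (f t)).symm
  rw [h3]
  exact (HypSpace.contMDiff_param.mdifferentiableAt (by simp)).comp t h1.mdifferentiableAt

theorem GOver.mdifferentiableAt_toHyp {c : ℝ → GOver n} {t : ℝ}
    (hc : DifferentiableAt ℝ (fun t => (c t).1.toMat) t) :
    MDifferentiableAt 𝓘(ℝ, ℝ) (𝓡 n) (fun t => (c t).toHyp) t := by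
  apply HypSpace.mdifferentiableAt_of_val
  have h1 : DifferentiableAt ℝ (fun t => (c t).1.1 *ᵥ timeVec n) t := by
    have h2 : ∀ t, (c t).1.1 *ᵥ timeVec n = fun i => (c t).1.toMat i (Fin.last n) := fun t =>
      (Matrix.mulVec_single_one _ _).trans rfl
    simp only [h2]
    exact differentiableAt_pi.2 fun i => differentiableAt_pi.1 (differentiableAt_pi.1 hc i) _
  have h3 : DifferentiableAt ℝ
      (fun t => -lorentz ((c t).1.1 *ᵥ timeVec n) ((c t).1.1 *ᵥ timeVec n)) t := by
    have h4 : ∀ i, DifferentiableAt ℝ (fun t => ((c t).1.1 *ᵥ timeVec n) i) t :=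
      differentiableAt_pi.1 h1
    simp only [lorentz]
    exact ((DifferentiableAt.fun_sum fun i _ => (h4 _).mul (h4 _)).sub ((h4 _).mul (h4 _))).neg
  simp only [GOver.coe_toHyp]
  have h5 := (c t).lorentz_neg
  exact ((h3.sqrt (by linarith)).inv (Real.sqrt_ne_zero'.2 (by linarith))).smul h1

end Projection

/-! ### The tractor bundle and its connection -/

section Tractor

variable {n : ℕ} (Γ : Subgroup (SOo n)) {V : Type u}
  [NormedAddCommGroup V] [NormedSpace ℝ V] (ρ : SmoothRep n V)

/-- Two elements of `G` over the same point differ by some `p ∈ P` on the right, and the factor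
`ρ(p)⁻¹` is absorbed by the relation defining the tractor bundle. So `[[g], ρ(g)⁻¹ w]` depends only
on `gP` and `w`. -/
theorem tractorMk_inv_apply (g : GOver n) (w : V) :
    tractorMk Γ ρ (cartanMk Γ g) (ρ g.1⁻¹ w) =
      tractorMk Γ ρ (cartanMk Γ (hypSection g.toHyp)) (ρ (hypSection g.toHyp).1⁻¹ w) := by
  rw [tractorMk_eq_of_smul Γ ρ g (hypSection g.toHyp) 1 (by rw [toHyp_hypSection, one_smul])]
  congr 1
  rw [← ρ.map_mul_apply]
  congr 2
  simp [mul_assoc]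

variable [IsTorsionFreeDiscrete Γ]

/-- With `τ = hypSection`, the transition map is `ρ(τ(γx)⁻¹ γ τ(x))`. Multiplying on the left by
`ρ(τ(γx))` leaves `ρ(γ) ρ(τ(x))`. -/
theorem tractorBundle_isFlatGauge : (tractorBundle Γ ρ).IsFlatGauge
    (fun x => ρ (hypSection x).1) (fun x => ρ (hypSection x).1⁻¹) (fun γ => ρ γ.1.1) where
  contMDiff := ρ.contMDiff_comp contMDiff_hypSection
  contMDiff_inv := ρ.contMDiff_comp (SL.contMDiff_inv contMDiff_hypSection)
  inv_apply x v := ρ.inv_apply_self _ v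
  apply_inv x v := ρ.apply_inv_self _ v
  equivariant γ x v := by
    change ρ _ (ρ ((hypSection (γ • x)).1⁻¹ * (γ.1.1 * (hypSection x).1)) v) = _
    rw [← ρ.map_mul_apply, mul_inv_cancel_left, ρ.map_mul_apply]

theorem tractorConnection_form (x : HypSpace n) (X : TangentSpace (𝓡 n) x) (v : V) :
    (ρ.differential ∘L maurerCartan (hypSection x).1 ∘L
      mvfderiv (𝓡 n) (fun y : HypSpace n => (hypSection y).1.toMat) x) X v =
      ρ (hypSection x).1⁻¹ (mvfderiv (𝓡 n) (fun y => ρ (hypSection y).1) x X v) := by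
  rw [ρ.mvfderiv_comp (contMDiff_hypSection.mdifferentiableAt (by simp))]
  exact (ρ.inv_apply_self _ _).symm

theorem fibLin_tractorBundle (g : GOver n) (w : V) :
    (tractorBundle Γ ρ).fibLin g.toHyp (quotProj Γ g.toHyp) rfl
      (ρ (hypSection g.toHyp).1⁻¹ w) = tractorClass Γ ρ (cartanMk Γ g) (ρ g.1⁻¹ w) :=
  Subtype.ext (tractorMk_inv_apply Γ ρ g w).symm

/-- The equivariant function is `σ(g) = ρ(g)⁻¹ F(gP)` with `F` the flat coordinates of `s`. Along a
curve its derivative is `-dρ(ω(ξ)) σ + ρ(g)⁻¹ dF`; adding the Cartan term leaves `ρ(g)⁻¹ dF`, the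
value of the connection in the gauge. -/
theorem isTractorConnection_tractorConnection [CompleteSpace V] :
    IsTractorConnection Γ ρ (tractorConnection Γ ρ) := by
  intro s σ hσ c ξ hc hs
  have hT := tractorBundle_isFlatGauge Γ ρ
  set F := (tractorBundle Γ ρ).flatCoords (fun x => ρ (hypSection x).1) s
  have hF : ∀ g : GOver n, σ (cartanMk Γ g) = ρ g.1⁻¹ (F g.toHyp) := fun g => by
    have h1 : s (quotProj Γ g.toHyp) = tractorClass Γ ρ (cartanMk Γ g) (ρ g.1⁻¹ (F g.toHyp)) :=
      (hT.fibLin_flatCoords s g.toHyp _ rfl).symm.trans (fibLin_tractorBundle Γ ρ g _)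
    -- `Γ` acts freely, so a vector of the fibre has a unique representative with first component
    -- `[g]`.
    exact tractorMk_injective Γ ρ g (congrArg Subtype.val ((hσ (cartanMk Γ g)).symm.trans h1))
  have hd : ∀ z, quotProj Γ z = quotProj Γ (c 0).toHyp → MDifferentiableAt (𝓡 n) 𝓘(ℝ, V) F z := by
    intro z hz
    refine hT.mdifferentiableAt_flatCoords ?_
    rw [hz]
    exact hs
  have hx : MDifferentiableAt 𝓘(ℝ, ℝ) (𝓡 n) (fun t => (c t).toHyp) 0 :=
    GOver.mdifferentiableAt_toHyp hc.differentiableAt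
  have hq : MDifferentiableAt (𝓡 n) (𝓡 n) (quotProj Γ) (c 0).toHyp :=
    (quotProj_contMDiff Γ).mdifferentiableAt (by simp)
  refine ⟨show MDifferentiableAt 𝓘(ℝ, ℝ) (𝓡 n) (quotProj Γ ∘ fun t => (c t).toHyp) 0 from
    hq.comp (0 : ℝ) hx, ?_⟩
  set X := mfderiv 𝓘(ℝ, ℝ) (𝓡 n) (fun t => (c t).toHyp) 0 (1 : ℝ)
  have hFx : HasDerivAt (fun t => F (c t).toHyp) (mvfderiv (𝓡 n) F (c 0).toHyp X) 0 := by
    have h1 : DifferentiableAt ℝ (fun t => F (c t).toHyp) 0 :=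
      (MDifferentiableAt.comp (g := F) (0 : ℝ) (hd _ rfl) hx).differentiableAt
    have h2 := mvfderiv_comp_map (g := F) (f := fun t => (c t).toHyp) (0 : ℝ) rfl (hd _ rfl) hx
      (1 : ℝ)
    refine h1.hasDerivAt.congr_deriv (Eq.trans ?_ h2)
    rw [mvfderiv, mfderiv_eq_fderiv]
    rfl
  have hv := (ρ.hasDerivAt_inv_comp hc).clm_apply hFx
  refine ⟨_, hv.congr_of_eventuallyEq (Eventually.of_forall fun t => hF (c t)), ?_⟩
  have hX := mfderiv_comp_apply (I := 𝓘(ℝ, ℝ)) (I' := 𝓡 n) (I'' := 𝓡 n) (0 : ℝ) hq hx (1 : ℝ)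
  refine (hT.conn_apply (tractorConnection_form ρ) rfl hd X _ hX).trans ?_
  refine (fibLin_tractorBundle Γ ρ (c 0) _).trans ?_
  congr 1
  rw [hF]
  -- The derivative of `ρ(c t)⁻¹` and the Cartan term are opposite.
  simp only [neg_apply, mul_apply_eq_comp, neg_add_cancel_comm]
  rfl

end Tractor

end HypTractor
end

/-! ### The isomorphism of flat bundles -/

open HypTractor
theorem theorem3p1 (n : ℕ) (hn : 2 ≤ n)
    -- the compact hyperbolic manifold `M = Γ \ ℍⁿ`
    (Γ : Subgroup (SOo n)) [IsTorsionFreeDiscrete Γ] [CompactSpace (QuotMfd Γ)]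
    {𝔼 : Type*} [NormedAddCommGroup 𝔼] [NormedSpace ℝ 𝔼] [FiniteDimensional ℝ 𝔼]
    {𝔽 : Type*} [NormedAddCommGroup 𝔽] [NormedSpace ℝ 𝔽] [FiniteDimensional ℝ 𝔽]
    (ρ : SmoothRep n 𝔼) (μ : SO n →* (𝔽 →L[ℝ] 𝔽))
    -- the isomorphism between `μ` and the restriction of `ρ`
    (θ : 𝔽 ≃ₗ[ℝ] 𝔼) (hθ : ∀ (A : SO n) (v : 𝔽), θ (μ A v) = ρ A.1 (θ v)) :
    -- the connections are the ones induced by the trivial and by the Cartan connection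
    IsDevConnection Γ μ (devConnection Γ μ) ∧
    IsTractorConnection Γ ρ (tractorConnection Γ ρ) ∧
    -- they are smooth and flat
    (devConnection Γ μ).ContMDiffCovariantDerivative ∞ ∧ IsFlat (devConnection Γ μ) ∧
    (tractorConnection Γ ρ).ContMDiffCovariantDerivative ∞ ∧ IsFlat (tractorConnection Γ ρ) ∧
    -- the canonical isomorphism
    ∃ Φ : ∀ m : QuotMfd Γ, (devBundle Γ μ).Fib m ≃L[ℝ] (tractorBundle Γ ρ).Fib m,
      (∀ (g : GOver n) (v : 𝔽), Φ (quotProj Γ g.toHyp) (devClass Γ μ g.toHyp v) =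
        tractorClass Γ ρ (cartanMk Γ g) (ρ g.1⁻¹ (θ v))) ∧
      ContMDiff ((𝓡 n).prod 𝓘(ℝ, 𝔽)) ((𝓡 n).prod 𝓘(ℝ, 𝔼)) ∞
        (fun p : TotalSpace 𝔽 (devBundle Γ μ).Fib => TotalSpace.mk' 𝔼 p.1 (Φ p.1 p.2)) ∧
      ContMDiff ((𝓡 n).prod 𝓘(ℝ, 𝔼)) ((𝓡 n).prod 𝓘(ℝ, 𝔽)) ∞
        (fun p : TotalSpace 𝔼 (tractorBundle Γ ρ).Fib =>
          TotalSpace.mk' 𝔽 p.1 ((Φ p.1).symm p.2)) ∧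
      ∀ (s : Π m, (devBundle Γ μ).Fib m) (m : QuotMfd Γ), DiffAt Γ s m →
        ∀ X : TangentSpace (𝓡 n) m,
          Φ m (devConnection Γ μ s m X) = tractorConnection Γ ρ (fun m' => Φ m' (s m')) m X := by
  have hD := devBundle_isFlatGauge Γ μ
  have hT := tractorBundle_isFlatGauge Γ ρ
  -- Only the restriction of `hθ` to `Γ` is needed to glue `θ` over `M`.
  have hC : ∀ (γ : Γ) (v : 𝔽), θ.toContinuousLinearEquiv (devRep Γ μ γ v) =
      ρ γ.1.1 (θ.toContinuousLinearEquiv v) := fun γ v => hθ _ v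
  have hC' : ∀ (γ : Γ) (v : 𝔼), θ.toContinuousLinearEquiv.symm (ρ γ.1.1 v) =
      devRep Γ μ γ (θ.toContinuousLinearEquiv.symm v) := fun γ v => by
    rw [ContinuousLinearEquiv.symm_apply_eq, hC, ContinuousLinearEquiv.apply_symm_apply]
  have : CompleteSpace 𝔼 := FiniteDimensional.complete ℝ 𝔼
  refine ⟨isDevConnection_devConnection Γ μ, isTractorConnection_tractorConnection Γ ρ,
    hD.contMDiffCovariantDerivative_conn devConnection_form,
    hD.isFlat_conn devConnection_form,
    hT.contMDiffCovariantDerivative_conn (tractorConnection_form ρ),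
    hT.isFlat_conn (tractorConnection_form ρ),
    hD.iso hT θ.toContinuousLinearEquiv, fun g v => ?_, hD.contMDiff_iso hT _ hC,
    -- The inverse of the isomorphism given by `θ` unfolds to the isomorphism given by `θ⁻¹` with
    -- the two bundles exchanged.
    hT.contMDiff_iso hD _ hC', hD.iso_conn hT _ hC devConnection_form (tractorConnection_form ρ)⟩
  -- The gauge of the first bundle is `1`, so `[x, v]` is the vector with flat coordinate `v` at
  -- `x`. Its image is computed in the frame of `hypSection` and then rewritten for the given `g`.
  exact (hD.iso_fibLin hT θ.toContinuousLinearEquiv hC g.toHyp _ rfl v).trans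
    (fibLin_tractorBundle Γ ρ g (θ v))
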